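/- Let $X$ be a CAT(0) cube complex, i.e. a nonempty simply connected cube complex in which the link of every vertex is a simplicial flag complex, and assume that $X$ is locally finite (no group action is assumed). Convex subcomplexes are nonempty, full subcomplexes whose $1$-skeleton is convex for the graph metric of $X^{(1)}$. Two convex subcomplexes are \emph{parallel} if they are crossed by the same hyperplanes. For a convex subcomplex $Y$, the gate map $\mathfrak g_Y$ is the cubical map $X\to Y$ that sends each vertex to the unique closest vertex of $Y$. A \emph{combinatorial hyperplane} is one of the two sides $H\times\{\pm\frac12\}$ of the carrier $\mathcal N(H)\cong H\times[-\frac12,\frac12]$ of a hyperplane $H$. The \emph{hyperclosure} $\mathfrak F$ of $X$ is the intersection of all sets $\mathfrak F'$ of convex subcomplexes of $X$ such that (1) $X\in\mathfrak F'$ and every combinatorial hyperplane of $X$ is in $\mathfrak F'$; (2) if $F,F'\in\mathfrak F'$ then $\mathfrak g_F(F')\in\mathfrak F'$; (3) if $F\in\mathfrak F'$ and $F'$ is a convex subcomplex parallel to $F$, then $F'\in\mathfrak F'$. For a convex subcomplex $A$ and a vertex $a\in A$, let $P_A$ be the convex hull of the union of all convex subcomplexes parallel to $A$. The \emph{orthogonal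 complement of $A$ at $a$} is the convex subcomplex $A^\perp\ni a$ for which there is a cubical isometric embedding $\phi:A\times A^\perp\to X$ with image $P_A$ such that $\phi(x,a)=x$ for all $x\in A$ and $\phi(a,y)=y$ for all $y\in A^\perp$. Then the following hold. (0) For every convex subcomplex $A$ of $X$ and every vertex $a\in A$, the orthogonal complement of $A$ at $a$ exists and is unique. (1) Let $F\subseteq X$ be a convex subcomplex. Then $F\in\mathfrak F$ if and only if there are a compact convex subcomplex $C$ of $X$ and a vertex $a\in C$ such that $F$ is the orthogonal complement of $C$ at $a$. (2) If $F\in\mathfrak F$, then $(F^\perp)^\perp=F$; that is, for every vertex $f\in F$, if $F^\perp$ is the orthogonal complement of $F$ at $f$, then the orthogonal complement of $F^\perp$ at $f$ is $F$. -/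

import Mathlib

/-- A face of the standard cube `{0,1}ⁿ`: some of the coordinates are held fixed. -/
def IsCubeFace {n : ℕ} (t : Set (Fin n → Bool)) : Prop :=
  ∃ (I : Set (Fin n)) (ε : Fin n → Bool), t = {x | ∀ i ∈ I, x i = ε i}

/-- `φ` identifies the vertices of a standard cube with a set of vertices in such a way that
the members of `cubes` contained in the image are exactly the faces. -/
def IsCubeChart {V : Type*} (cubes : Set (Set V)) {n : ℕ} (φ : (Fin n → Bool) → V) : Prop :=
  Function.Injective φ ∧
    ∀ s ⊆ Set.range φ, s ∈ cubes ↔ ∃ t, IsCubeFace t ∧ s = φ '' t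

/-- A cube complex with vertex set `V`, given by the vertex sets of its (closed) cubes: every
cube is, together with its faces, a standard cube, and two cubes which meet do so in a common
face. -/
structure CubeComplex (V : Type*) where
  cubes : Set (Set V)
  singleton_mem : ∀ v : V, {v} ∈ cubes
  exists_chart : ∀ c ∈ cubes, ∃ (n : ℕ) (φ : (Fin n → Bool) → V),
    IsCubeChart cubes φ ∧ Set.range φ = c
  inter_mem : ∀ c ∈ cubes, ∀ d ∈ cubes, (c ∩ d).Nonempty → c ∩ d ∈ cubes

namespace CubeComplex

variable {V : Type*}

/-- The 1-skeleton. -/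
def graph (X : CubeComplex V) : SimpleGraph V where
  Adj a b := a ≠ b ∧ ({a, b} : Set V) ∈ X.cubes
  symm := ⟨fun a b h => ⟨h.1.symm, by rw [Set.pair_comm]; exact h.2⟩⟩
  loopless := ⟨fun _ h => h.1 rfl⟩

/-- The simplices of the link of the vertex `v`: the cubes `c` containing `v`, each recorded by
the set of those neighbours of `v` that lie in `c`. -/
def link (X : CubeComplex V) (v : V) : Set (Set V) :=
  {s | ∃ c ∈ X.cubes, v ∈ c ∧ s = {w ∈ c | X.graph.Adj v w}}

/-- The link of `v` is a flag complex: a finite set of vertices of the link which pairwise span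
an edge of the link (or coincide) spans a simplex. -/
def FlagLink (X : CubeComplex V) (v : V) : Prop :=
  ∀ s : Set V, s.Finite → (∀ w ∈ s, ∀ w' ∈ s, {w, w'} ∈ X.link v) → s ∈ X.link v

/-- Homotopy (with fixed endpoints) of edge paths: generated by the removal of backtracks and
by pushing a path across a 2-cube. -/
inductive Homotopic (X : CubeComplex V) :
    ∀ {u v : V}, X.graph.Walk u v → X.graph.Walk u v → Prop
  | refl {u v : V} (p : X.graph.Walk u v) : Homotopic X p p
  | symm {u v : V} {p q : X.graph.Walk u v} : Homotopic X p q → Homotopic X q p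
  | trans {u v : V} {p q r : X.graph.Walk u v} :
      Homotopic X p q → Homotopic X q r → Homotopic X p r
  | append {u v w : V} {p p' : X.graph.Walk u v} {q q' : X.graph.Walk v w} :
      Homotopic X p p' → Homotopic X q q' → Homotopic X (p.append q) (p'.append q')
  | backtrack {u v : V} (h : X.graph.Adj u v) :
      Homotopic X (.cons h (.cons h.symm .nil)) .nil
  | square {a b c d : V} (hab : X.graph.Adj a b) (hbc : X.graph.Adj b c)
      (had : X.graph.Adj a d) (hdc : X.graph.Adj d c) (hs : ({a, b, c, d} : Set V) ∈ X.cubes) :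
      Homotopic X (.cons hab (.cons hbc .nil)) (.cons had (.cons hdc .nil))

/-- Simple connectivity: the complex is nonempty and connected, and its edge-path group is
trivial. -/
def IsSimplyConnected (X : CubeComplex V) : Prop :=
  X.graph.Connected ∧ ∀ (v : V) (p : X.graph.Walk v v), X.Homotopic p .nil

/-- A CAT(0) cube complex. -/
def IsCAT0 (X : CubeComplex V) : Prop :=
  X.IsSimplyConnected ∧ ∀ v, X.FlagLink v

/-- Every vertex lies in only finitely many cubes. -/
def IsLocallyFinite (X : CubeComplex V) : Prop :=
  ∀ v, {c ∈ X.cubes | v ∈ c}.Finite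

/-- A subcomplex: a set of cubes closed under passing to faces. -/
@[ext] structure Subcomplex (X : CubeComplex V) where
  cubes : Set (Set V)
  subset : cubes ⊆ X.cubes
  down_closed : ∀ c ∈ cubes, ∀ d ∈ X.cubes, d ⊆ c → d ∈ cubes

variable {X : CubeComplex V}

/-- The set of vertices of a subcomplex. -/
def Subcomplex.verts (Y : X.Subcomplex) : Set V := {v | {v} ∈ Y.cubes}

/-- Convexity: `Y` is full and contains every vertex on a geodesic of the 1-skeleton of `X`
between two vertices of `Y`. -/
def Subcomplex.IsConvex (Y : X.Subcomplex) : Prop :=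
  (∀ c ∈ X.cubes, c ⊆ Y.verts → c ∈ Y.cubes) ∧
    ∀ x ∈ Y.verts, ∀ y ∈ Y.verts, ∀ z,
      X.graph.dist x z + X.graph.dist z y = X.graph.dist x y → z ∈ Y.verts

/-- A subcomplex is compact exactly when it has finitely many cubes. -/
def Subcomplex.IsCompact (Y : X.Subcomplex) : Prop := Y.cubes.Finite

/-- The whole complex. -/
def whole (X : CubeComplex V) : X.Subcomplex where
  cubes := X.cubes
  subset := subset_rfl
  down_closed _ _ _ hd _ := hd

/-- The convex hull of a set of cubes: the intersection of all convex subcomplexes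
containing it. -/
def hull (X : CubeComplex V) (S : Set (Set V)) : X.Subcomplex where
  cubes := {c ∈ X.cubes | ∀ Y : X.Subcomplex, Y.IsConvex → S ⊆ Y.cubes → c ∈ Y.cubes}
  subset _ h := h.1
  down_closed c hc d hd hdc :=
    ⟨hd, fun Y hY hS => Y.down_closed c (hc.2 Y hY hS) d hd hdc⟩

/-- The set `M` of edges consists of the edges of the cube with chart `φ` that cross the midcube
on which the `i`-th coordinate vanishes. -/
def IsMidcube {n : ℕ} (φ : (Fin n → Bool) → V) (i : Fin n) (M : Set (Sym2 V)) : Prop :=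
  M = {e | ∃ x, e = s(φ x, φ (Function.update x i (!x i)))}

/-- The edges of the set `E` that lie in the cube `c`. -/
def edgesIn (E : Set (Sym2 V)) (c : Set V) : Set (Sym2 V) := {e ∈ E | ∀ v ∈ e, v ∈ c}

/-- A hyperplane, recorded by the set `E` of edges that it crosses: it meets every cube in the
empty set or in a single midcube, and it is (nonempty and) connected. -/
structure IsHyperplane (X : CubeComplex V) (E : Set (Sym2 V)) : Prop where
  nonempty : E.Nonempty
  subset_edges : E ⊆ X.graph.edgeSet
  midcube : ∀ c ∈ X.cubes, edgesIn E c = ∅ ∨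
    ∃ (n : ℕ) (φ : (Fin n → Bool) → V) (i : Fin n),
      IsCubeChart X.cubes φ ∧ Set.range φ = c ∧ IsMidcube φ i (edgesIn E c)
  connected : ∀ e ∈ E, ∀ e' ∈ E, Relation.ReflTransGen
    (fun f f' => ∃ c ∈ X.cubes, f ∈ edgesIn E c ∧ f' ∈ edgesIn E c) e e'

/-- The hyperplane `E` crosses (that is, intersects) the subcomplex `Y`. -/
def Crosses (E : Set (Sym2 V)) (Y : X.Subcomplex) : Prop :=
  ∃ c ∈ Y.cubes, (edgesIn E c).Nonempty

/-- `K` is one of the two combinatorial hyperplanes associated with the hyperplane `E`. If `c` is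
a cube crossed by `E`, then `K` meets `c` exactly in one of the two faces of `c` parallel to the
midcube in which `E` meets `c`, and `K` consists of these faces; thus `K` is one of the two sides
of the carrier of `E`. -/
def IsCombHyperplaneOf (E : Set (Sym2 V)) (K : X.Subcomplex) : Prop :=
  (∀ c ∈ X.cubes, (edgesIn E c).Nonempty →
    ∃ (n : ℕ) (φ : (Fin n → Bool) → V) (i : Fin n),
      IsCubeChart X.cubes φ ∧ Set.range φ = c ∧ IsMidcube φ i (edgesIn E c) ∧
        c ∩ K.verts = φ '' {x | x i = true}) ∧
  K.cubes = {d | ∃ c ∈ X.cubes, (edgesIn E c).Nonempty ∧ d = c ∩ K.verts}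

/-- `K` is a combinatorial hyperplane. -/
def IsCombHyperplane (K : X.Subcomplex) : Prop :=
  ∃ E, X.IsHyperplane E ∧ IsCombHyperplaneOf E K

/-- Two subcomplexes are parallel if they are crossed by the same hyperplanes. -/
def Parallel (F F' : X.Subcomplex) : Prop :=
  ∀ E, X.IsHyperplane E → (Crosses E F ↔ Crosses E F')

/-- `y` is the gate of `v` in `Y`: the unique vertex of `Y` closest to `v`. -/
def IsGate (Y : X.Subcomplex) (v y : V) : Prop :=
  y ∈ Y.verts ∧ ∀ z ∈ Y.verts, z ≠ y → X.graph.dist v y < X.graph.dist v z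

/-- The image of `Y'` under the gate map to `Y`, which sends the cube with vertex set `c` onto the
cube whose vertices are the gates of the vertices in `c`; the image consists of these cubes
and their faces. -/
def gateImage (Y Y' : X.Subcomplex) : X.Subcomplex where
  cubes := {d ∈ X.cubes | ∃ c ∈ Y'.cubes, d ⊆ {y | ∃ v ∈ c, IsGate Y v y}}
  subset _ h := h.1
  down_closed _ hc _ hd hdc := ⟨hd, hc.2.choose, hc.2.choose_spec.1,
    hdc.trans hc.2.choose_spec.2⟩

/-- The families of (nonempty) convex subcomplexes which contain the whole complex and all
combinatorial hyperplanes, and are closed under gate projection and under parallelism. -/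
structure IsHyperclosed (X : CubeComplex V) (𝓕 : Set X.Subcomplex) : Prop where
  convex : ∀ F ∈ 𝓕, F.IsConvex ∧ F.verts.Nonempty
  whole_mem : X.whole ∈ 𝓕
  combHyperplane_mem : ∀ K : X.Subcomplex, IsCombHyperplane K → K ∈ 𝓕
  gate_mem : ∀ F ∈ 𝓕, ∀ F' ∈ 𝓕, gateImage F F' ∈ 𝓕
  parallel_mem : ∀ F ∈ 𝓕, ∀ F' : X.Subcomplex, F'.IsConvex → F'.verts.Nonempty →
    Parallel F' F → F' ∈ 𝓕

/-- The hyperclosure: the intersection of all these families. -/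
def hyperclosure (X : CubeComplex V) : Set X.Subcomplex :=
  ⋂₀ {𝓕 | X.IsHyperclosed 𝓕}

/-- The convex hull of the union of all parallel copies of `A`. -/
def parallelHull (A : X.Subcomplex) : X.Subcomplex :=
  X.hull {c | ∃ A' : X.Subcomplex, A'.IsConvex ∧ A'.verts.Nonempty ∧ Parallel A' A ∧ c ∈ A'.cubes}

/-- `O` is the orthogonal complement of `A` at the vertex `a` of `A`: there is a cubical isometric
embedding `φ` of the product `A × O` into `X`, whose image is the convex hull of all parallel
copies of `A`, which restricts to the inclusion of `A` on `A × {a}`, and which carries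
`{a} × O` to `O` by the inclusion. The product carries the sum of the two distances. -/
def IsOrthCompl (A : X.Subcomplex) (a : V) (O : X.Subcomplex) : Prop :=
  a ∈ A.verts ∧ a ∈ O.verts ∧ O.IsConvex ∧
  ∃ φ : V × V → V,
    (∀ x ∈ A.verts, φ (x, a) = x) ∧ (∀ y ∈ O.verts, φ (a, y) = y) ∧
    (∀ x ∈ A.verts, ∀ y ∈ O.verts, ∀ x' ∈ A.verts, ∀ y' ∈ O.verts,
      X.graph.dist (φ (x, y)) (φ (x', y')) = X.graph.dist x x' + X.graph.dist y y') ∧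
    (parallelHull A).cubes = {d | ∃ c ∈ A.cubes, ∃ c' ∈ O.cubes, d = φ '' (c ×ˢ c')}

end CubeComplex

/-!
The proof translates everything into statements about halfspaces.

*From local to global.* Edge paths issuing from a fixed vertex are considered up to swaps, which
push the path across a square, and a path is reduced if no swaps make it backtrack. The flag
condition makes swap equivalence transitive when it is defined by recursion on the last edge
(`SwapEq.trans`). Continuing a reduced path along an edge, with cancellation, gives an action of
edges on the classes of reduced paths which respects backtracks and squares (`Step.square`), hence
is invariant under homotopy. As `X` is simply connected, reduced paths with the same endpoints are
swap equivalent (`IsCAT0.swapEq_of_reduced`); in particular all of them are geodesics. This yields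
the two properties of the 1-skeleton on which everything else rests: it is bipartite, and two
neighbours of `v` which are closer to `o` than `v` span a square with `v` whose opposite corner is
closer still (`IsCAT0.quadrangle`).

*Halfspaces.* It follows that opposite edges of squares bound the same halfspaces, that hyperplanes
are the sets of edges leaving a halfspace, that the distance of two vertices is the number of
halfspaces containing the first but not the second, and that convex sets have gates. A convex set
is determined by one vertex and the set `Cross S` of halfspaces it crosses
(`IsConvexSet.eq_span`); a gate image crosses exactly the halfspaces crossed by both sets
(`cross_gate_image`); cubes are the convex sets crossing finitely many halfspaces any two of which
are equal, complementary or transverse (`mem_cubes_iff`).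

*The theorem.* For a set `U` of halfspaces let `perp U` be the set of halfspaces transverse to all
members of `U`. The orthogonal complement of `A` at `a` consists of the vertices separated from `a`
only by members of `perp (Cross A)`, and these are also the halfspaces it crosses
(`cross_span_perp`, `isOrthCompl_iff`). A convex subcomplex belongs to the hyperclosure if and only
if it crosses exactly the members of `perp U` for some finite `U` (`mem_hyperclosure_iff`), as
`perp {h}` is the set of halfspaces crossed by a combinatorial hyperplane and gate images correspond
to unions of the sets `U`. Such a `U` can be replaced by the set of halfspaces crossed by a compact
convex subcomplex (`exists_finite_cross_perp_eq`), and `perp (perp (perp U)) = perp U` gives the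
statement on double complements.
-/

namespace CubeComplex

variable {V : Type*} {X : CubeComplex V}

/-! ### Charts and squares -/

/-- The vertex of the standard cube obtained from `x` by changing its `i`-th coordinate. -/
def flipAt {n : ℕ} (x : Fin n → Bool) (i : Fin n) : Fin n → Bool :=
  Function.update x i (!x i)

theorem flipAt_same {n : ℕ} (x : Fin n → Bool) (i : Fin n) : flipAt x i i = !x i := by
  simp [flipAt]

theorem flipAt_of_ne {n : ℕ} (x : Fin n → Bool) {i j : Fin n} (h : j ≠ i) :
    flipAt x i j = x j := by
  simp [flipAt, h]

theorem flipAt_apply {n : ℕ} (x : Fin n → Bool) (i j : Fin n) :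
    flipAt x i j = if j = i then !x j else x j := by
  by_cases h : j = i
  · subst h; simp [flipAt_same]
  · simp [flipAt_of_ne x h, h]

theorem flipAt_flipAt {n : ℕ} (x : Fin n → Bool) (i : Fin n) : flipAt (flipAt x i) i = x := by
  funext j; simp only [flipAt_apply]; split <;> simp

theorem flipAt_comm {n : ℕ} (x : Fin n → Bool) (i j : Fin n) :
    flipAt (flipAt x i) j = flipAt (flipAt x j) i := by
  funext k; simp only [flipAt_apply]; split <;> split <;> rfl

theorem flipAt_ne_self {n : ℕ} (x : Fin n → Bool) (i : Fin n) : flipAt x i ≠ x := fun h => by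
  have := congrFun h i
  simp [flipAt_same] at this

theorem flipAt_inj {n : ℕ} {x : Fin n → Bool} {i j : Fin n} (h : flipAt x i = flipAt x j) :
    i = j := by
  by_contra hij
  have := congrFun h i
  simp [flipAt_same, flipAt_of_ne x hij] at this

theorem flipAt_flipAt_ne_flipAt {n : ℕ} {x : Fin n → Bool} {i j : Fin n} (k : Fin n)
    (hij : i ≠ j) : flipAt (flipAt x i) j ≠ flipAt x k := fun h => by
  have h1 := congrFun h i
  have h2 := congrFun h j
  simp only [flipAt_apply, if_neg hij, if_neg hij.symm, if_true] at h1 h2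
  by_cases hi : i = k
  · subst hi; simp [hij.symm] at h2
  · simp [hi] at h1

theorem flipAt_flipAt_ne_self {n : ℕ} {x : Fin n → Bool} {i j : Fin n}
    (hij : i ≠ j) : flipAt (flipAt x i) j ≠ x := fun h =>
  hij (flipAt_inj (x := x) (by rw [← flipAt_flipAt (flipAt x i) j, h]))

theorem chart_adj {n : ℕ} {φ : (Fin n → Bool) → V} (hφ : IsCubeChart X.cubes φ)
    {x y : Fin n → Bool} : X.graph.Adj (φ x) (φ y) ↔ ∃ i, y = flipAt x i := by
  have hsub : ({φ x, φ y} : Set V) ⊆ Set.range φ := by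
    rintro _ (rfl | rfl) <;> exact ⟨_, rfl⟩
  constructor
  · rintro ⟨hne, hc⟩
    obtain ⟨t, ⟨I, ε, rfl⟩, ht⟩ := (hφ.2 _ hsub).1 hc
    have hmem : ∀ z, z ∈ {x | ∀ i ∈ I, x i = ε i} ↔ z = x ∨ z = y := fun z => by
      rw [← hφ.1.mem_set_image, ← ht]
      simp [hφ.1.eq_iff]
    obtain ⟨i, hi⟩ : ∃ i, x i ≠ y i := by
      by_contra! h
      exact hne (congrArg φ (funext h))
    refine ⟨i, ?_⟩
    have hx := (hmem x).2 (Or.inl rfl)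
    have hy := (hmem y).2 (Or.inr rfl)
    have hiI : i ∉ I := fun h => hi ((hx i h).trans (hy i h).symm)
    have hfl : flipAt x i ∈ {x | ∀ i ∈ I, x i = ε i} := fun j hj => by
      have hji : j ≠ i := by rintro rfl; exact hiI hj
      rw [flipAt_of_ne x hji]; exact hx j hj
    rcases (hmem (flipAt x i)).1 hfl with h | h
    · exact absurd h (flipAt_ne_self x i)
    · exact h.symm
  · rintro ⟨i, rfl⟩
    refine ⟨fun h => flipAt_ne_self x i (hφ.1 h).symm, (hφ.2 _ hsub).2
      ⟨{z | ∀ j ∈ ({i}ᶜ : Set (Fin n)), z j = x j}, ⟨_, _, rfl⟩, ?_⟩⟩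
    rw [← Set.image_pair]
    congr 1
    ext z
    simp only [Set.mem_insert_iff, Set.mem_singleton_iff, Set.mem_compl_iff, Set.mem_ofPred_eq]
    constructor
    · rintro (rfl | rfl) j hj
      · rfl
      · exact flipAt_of_ne x hj
    · intro h
      by_cases hz : z i = x i
      · left; funext j
        by_cases hj : j = i
        · rw [hj, hz]
        · exact h j hj
      · right; funext j
        by_cases hj : j = i
        · subst hj; rw [flipAt_same]; cases h1 : z j <;> cases h2 : x j <;> simp_all
        · rw [flipAt_of_ne x hj, h j hj]

/-- `a, b, c, d` are the consecutive vertices of a 2-cube. -/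
structure Sq (X : CubeComplex V) (a b c d : V) : Prop where
  ab : X.graph.Adj a b
  bc : X.graph.Adj b c
  cd : X.graph.Adj c d
  da : X.graph.Adj d a
  ac : a ≠ c
  bd : b ≠ d
  mem : ({a, b, c, d} : Set V) ∈ X.cubes

theorem Sq.rotate {a b c d : V} (h : X.Sq a b c d) : X.Sq b c d a :=
  ⟨h.bc, h.cd, h.da, h.ab, h.bd, h.ac.symm, by
    have := h.mem
    have e : ({b, c, d, a} : Set V) = {a, b, c, d} := by ext; simp; tauto
    rwa [e]⟩

theorem Sq.reflect {a b c d : V} (h : X.Sq a b c d) : X.Sq a d c b :=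
  ⟨h.da.symm, h.cd.symm, h.bc.symm, h.ab.symm, h.ac, h.bd.symm, by
    have := h.mem
    have e : ({a, d, c, b} : Set V) = {a, b, c, d} := by ext; simp; tauto
    rwa [e]⟩

theorem chart_sq {n : ℕ} {φ : (Fin n → Bool) → V} (hφ : IsCubeChart X.cubes φ)
    (x : Fin n → Bool) {i j : Fin n} (hij : i ≠ j) :
    X.Sq (φ x) (φ (flipAt x i)) (φ (flipAt (flipAt x i) j)) (φ (flipAt x j)) where
  ab := (chart_adj hφ).2 ⟨i, rfl⟩
  bc := (chart_adj hφ).2 ⟨j, rfl⟩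
  cd := (chart_adj hφ).2 ⟨i, by rw [flipAt_comm, flipAt_flipAt]⟩
  da := (chart_adj hφ).2 ⟨j, (flipAt_flipAt _ _).symm⟩
  ac h := flipAt_flipAt_ne_self hij (hφ.1 h).symm
  bd h := hij (flipAt_inj (hφ.1 h))
  mem := by
    have hsub : ({φ x, φ (flipAt x i), φ (flipAt (flipAt x i) j), φ (flipAt x j)} : Set V) ⊆
        Set.range φ := by
      rintro _ (rfl | rfl | rfl | rfl) <;> exact ⟨_, rfl⟩
    refine (hφ.2 _ hsub).2 ⟨{z | ∀ k ∈ ({i, j}ᶜ : Set (Fin n)), z k = x k}, ⟨_, _, rfl⟩, ?_⟩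
    simp only [← Set.image_singleton (f := φ), ← Set.image_insert_eq]
    congr 1
    ext z
    simp only [Set.mem_insert_iff, Set.mem_singleton_iff, Set.mem_compl_iff, Set.mem_ofPred_eq,
      not_or]
    constructor
    · rintro (rfl | rfl | rfl | rfl) k ⟨hk, hk'⟩ <;> simp [flipAt_apply, hk, hk']
    · intro h
      have key : ∀ y : Fin n → Bool, y i = z i → y j = z j → (∀ k, k ≠ i → k ≠ j → y k = x k) →
          z = y := fun y h1 h2 h3 => by
        funext k
        by_cases hi : k = i
        · rw [hi, h1]
        by_cases hj : k = j
        · rw [hj, h2]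
        rw [h3 k hi hj, h k ⟨hi, hj⟩]
      have hji := hij.symm
      by_cases h1 : z i = x i <;> by_cases h2 : z j = x j
      · exact Or.inl (key _ h1.symm h2.symm fun _ _ _ => rfl)
      · refine Or.inr (Or.inr (Or.inr (key _ ?_ ?_ ?_)))
        · simp [flipAt_apply, hij, h1]
        · cases h3 : z j <;> cases h4 : x j <;> simp_all [flipAt_apply]
        · intro k _ hj; simp [flipAt_apply, hj]
      · refine Or.inr (Or.inl (key _ ?_ ?_ ?_))
        · cases h3 : z i <;> cases h4 : x i <;> simp_all [flipAt_apply]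
        · simp [flipAt_apply, hji, h2]
        · intro k hi _; simp [flipAt_apply, hi]
      · refine Or.inr (Or.inr (Or.inl (key _ ?_ ?_ ?_)))
        · cases h3 : z i <;> cases h4 : x i <;> simp_all [flipAt_apply]
        · cases h3 : z j <;> cases h4 : x j <;> simp_all [flipAt_apply]
        · intro k hi hj; simp [flipAt_apply, hi, hj]

/-- Two edges `ab`, `ad` of a cube span a square of that cube. -/
theorem exists_sq_of_mem {c : Set V} (hc : c ∈ X.cubes) {a b d : V} (ha : a ∈ c) (hb : b ∈ c)
    (hd : d ∈ c) (hab : X.graph.Adj a b) (had : X.graph.Adj a d) (hbd : b ≠ d) :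
    ∃ e ∈ c, X.Sq a b e d ∧ ¬ X.graph.Adj a e := by
  obtain ⟨n, φ, hφ, rfl⟩ := X.exists_chart c hc
  obtain ⟨x, rfl⟩ := ha
  obtain ⟨y, rfl⟩ := hb
  obtain ⟨z, rfl⟩ := hd
  obtain ⟨i, rfl⟩ := (chart_adj hφ).1 hab
  obtain ⟨j, rfl⟩ := (chart_adj hφ).1 had
  have hij : i ≠ j := fun h => hbd (by rw [h])
  refine ⟨_, ⟨_, rfl⟩, chart_sq hφ x hij, fun h => ?_⟩
  obtain ⟨k, hk⟩ := (chart_adj hφ).1 h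
  exact flipAt_flipAt_ne_flipAt k hij hk

theorem Sq.of_mem {a b c d : V} (hab : X.graph.Adj a b) (had : X.graph.Adj a d)
    (hs : ({a, b, c, d} : Set V) ∈ X.cubes) (hbd : b ≠ d) : X.Sq a b c d := by
  obtain ⟨e, he, hsq, -⟩ := exists_sq_of_mem hs (a := a) (b := b) (d := d) (by simp) (by simp)
    (by simp) hab had hbd
  have : e = c := by
    rcases he with h | h | h | h
    · exact absurd h.symm hsq.ac
    · exact absurd h.symm hsq.bc.ne
    · exact h
    · exact absurd h hsq.cd.ne
  exact this ▸ hsq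

theorem Sq.not_adj {a b c d : V} (h : X.Sq a b c d) : ¬ X.graph.Adj a c := by
  obtain ⟨e, he, hsq, hn⟩ := exists_sq_of_mem h.mem (a := a) (b := b) (d := d) (by simp) (by simp)
    (by simp) h.ab h.da.symm h.bd
  have : e = c := by
    rcases he with h | h | h | h
    · exact absurd h.symm hsq.ac
    · exact absurd h.symm hsq.bc.ne
    · exact h
    · exact absurd h hsq.cd.ne
  exact this ▸ hn

/-- Two squares with three vertices in common are equal. -/
theorem Sq.unique {a b c c' d : V} (h : X.Sq a b c d) (h' : X.Sq a b c' d) : c = c' := by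
  by_contra hne
  have hi := X.inter_mem _ h.mem _ h'.mem ⟨a, by simp, by simp⟩
  obtain ⟨e, he, hsq, -⟩ := exists_sq_of_mem hi (a := a) (b := b) (d := d) (by simp) (by simp)
    (by simp) h.ab h.da.symm h.bd
  have key : ∀ c₀, X.Sq a b c₀ d → e ∈ ({a, b, c₀, d} : Set V) → e = c₀ := by
    rintro c₀ - (h | h | h | h)
    · exact absurd h.symm hsq.ac
    · exact absurd h.symm hsq.bc.ne
    · exact h
    · exact absurd h hsq.cd.ne
  exact hne ((key c h he.1).symm.trans (key c' h' he.2))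

theorem singleton_mem_link {v w : V} (h : X.graph.Adj v w) : ({w} : Set V) ∈ X.link v := by
  refine ⟨{v, w}, h.2, by simp, ?_⟩
  ext z
  simp only [Set.mem_singleton_iff, Set.mem_insert_iff, Set.mem_ofPred_eq]
  constructor
  · rintro rfl; exact ⟨Or.inr rfl, h⟩
  · rintro ⟨rfl | rfl, h'⟩
    · exact absurd rfl h'.ne
    · rfl

theorem Sq.pair_mem_link {a b c d : V} (h : X.Sq a b c d) : ({b, d} : Set V) ∈ X.link a := by
  refine ⟨_, h.mem, by simp, ?_⟩
  ext z
  simp only [Set.mem_singleton_iff, Set.mem_insert_iff, Set.mem_ofPred_eq]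
  constructor
  · rintro (rfl | rfl)
    · exact ⟨by simp, h.ab⟩
    · exact ⟨by simp, h.da.symm⟩
  · rintro ⟨rfl | rfl | rfl | rfl, h'⟩
    · exact absurd rfl h'.ne
    · simp
    · exact absurd h' h.not_adj
    · simp

/-- The flag condition for vertices of a link which pairwise span squares. -/
theorem exists_cube_of_flag {w : V} (hX : X.FlagLink w) {s : Set V} (hs : s.Finite)
    (hadj : ∀ v ∈ s, X.graph.Adj w v)
    (hsq : ∀ v ∈ s, ∀ x ∈ s, v ≠ x → ∃ u, X.Sq w v u x) :
    ∃ c ∈ X.cubes, w ∈ c ∧ s = {v ∈ c | X.graph.Adj w v} := by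
  refine hX s hs fun v hv x hx => ?_
  by_cases hvx : v = x
  · subst hvx
    rw [Set.pair_eq_singleton]
    exact singleton_mem_link (hadj v hv)
  · obtain ⟨u, hu⟩ := hsq v hv x hx hvx
    exact hu.pair_mem_link

/-- Three squares which pairwise share an edge at `w` are faces of a 3-cube. -/
theorem exists_three_cube {w v x y u z t : V} (hX : X.FlagLink w) (h₁ : X.Sq w v u x)
    (h₂ : X.Sq w v z y) (h₃ : X.Sq w x t y) :
    ∃ s, X.Sq v u s z ∧ X.Sq x u s t ∧ X.Sq y z s t := by
  obtain ⟨c, hc, hw, hs⟩ := exists_cube_of_flag hX (s := {v, x, y}) (by simp)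
    (by rintro _ (rfl | rfl | rfl)
        exacts [h₁.ab, h₁.da.symm, h₂.da.symm])
    (by
      rintro _ (rfl | rfl | rfl) _ (rfl | rfl | rfl) h
      · exact absurd rfl h
      · exact ⟨_, h₁⟩
      · exact ⟨_, h₂⟩
      · exact ⟨_, h₁.reflect⟩
      · exact absurd rfl h
      · exact ⟨_, h₃⟩
      · exact ⟨_, h₂.reflect⟩
      · exact ⟨_, h₃.reflect⟩
      · exact absurd rfl h)
  have hv : v ∈ c := ((Set.ext_iff.1 hs v).1 (by simp)).1
  have hx : x ∈ c := ((Set.ext_iff.1 hs x).1 (by simp)).1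
  have hy : y ∈ c := ((Set.ext_iff.1 hs y).1 (by simp)).1
  obtain ⟨n, φ, hφ, rfl⟩ := X.exists_chart c hc
  obtain ⟨x₀, rfl⟩ := hw
  obtain ⟨v, rfl⟩ := hv
  obtain ⟨x, rfl⟩ := hx
  obtain ⟨y, rfl⟩ := hy
  obtain ⟨i, rfl⟩ := (chart_adj hφ).1 h₁.ab
  obtain ⟨j, rfl⟩ := (chart_adj hφ).1 h₁.da.symm
  obtain ⟨k, rfl⟩ := (chart_adj hφ).1 h₂.da.symm
  have hij : i ≠ j := fun h => h₁.bd (by rw [h])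
  have hik : i ≠ k := fun h => h₂.bd (by rw [h])
  have hjk : j ≠ k := fun h => h₃.bd (by rw [h])
  obtain rfl := h₁.unique (chart_sq hφ x₀ hij)
  obtain rfl := h₂.unique (chart_sq hφ x₀ hik)
  obtain rfl := h₃.unique (chart_sq hφ x₀ hjk)
  refine ⟨φ (flipAt (flipAt (flipAt x₀ i) j) k), chart_sq hφ _ hjk, ?_, ?_⟩
  · have := chart_sq hφ (flipAt x₀ j) hik
    rwa [flipAt_comm x₀ j i] at this
  · have := chart_sq hφ (flipAt x₀ k) hij
    rwa [flipAt_comm x₀ k i, flipAt_comm x₀ k j, flipAt_comm _ k j] at this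

/-! ### Normal forms of edge paths -/

/-- Swap equivalence of edge paths issuing from `o`. A path is the list of its vertices in reverse
order, so that the head of the list is its endpoint and the last entry is `o`. Two paths with
the same endpoint `v` are equivalent if their last edges agree and the remaining paths are
equivalent, or if their last edges are adjacent edges of a square at `v` and both remaining paths
can be continued from one path to the opposite corner of that square. -/
inductive SwapEq (X : CubeComplex V) (o : V) : List V → List V → Prop
  | base : SwapEq X o [o] [o]
  | cons {v u : V} {p q : List V} : X.graph.Adj u v → SwapEq X o (u :: p) (u :: q) →
      SwapEq X o (v :: u :: p) (v :: u :: q)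
  | sq {v u w x : V} {p q r : List V} : X.Sq v u x w → SwapEq X o (u :: p) (u :: x :: r) →
      SwapEq X o (w :: q) (w :: x :: r) → SwapEq X o (v :: u :: p) (v :: w :: q)

namespace SwapEq

variable {o : V} {p q r : List V}

theorem symm (h : X.SwapEq o p q) : X.SwapEq o q p := by
  induction h with
  | base => exact base
  | cons h _ ih => exact cons h ih
  | sq h h₁ h₂ _ _ => exact sq h.reflect h₂ h₁

theorem left (h : X.SwapEq o p q) : X.SwapEq o p p := by
  induction h with
  | base => exact base
  | cons h _ ih => exact cons h ih
  | sq h _ _ ih _ => exact cons h.ab.symm ih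

theorem right (h : X.SwapEq o p q) : X.SwapEq o q q := h.symm.left

theorem length_eq (h : X.SwapEq o p q) : p.length = q.length := by
  induction h with
  | base => rfl
  | cons _ _ ih => simpa using ih
  | sq _ _ _ ih₁ ih₂ => simp at ih₁ ih₂ ⊢; omega

theorem head_eq (h : X.SwapEq o p q) : p.head? = q.head? := by
  cases h <;> rfl

theorem exists_cons (h : X.SwapEq o p q) : ∃ v p', p = v :: p' := by
  cases h <;> exact ⟨_, _, rfl⟩

theorem inv {v u w : V} (h : X.SwapEq o (v :: u :: p) (v :: w :: q)) :
    (u = w ∧ X.SwapEq o (u :: p) (u :: q)) ∨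
      ∃ x r, X.Sq v u x w ∧ X.SwapEq o (u :: p) (u :: x :: r) ∧
        X.SwapEq o (w :: q) (w :: x :: r) := by
  cases h with
  | cons _ h => exact Or.inl ⟨rfl, h⟩
  | sq h h₁ h₂ => exact Or.inr ⟨_, _, h, h₁, h₂⟩

theorem inv_left {v u : V} (h : X.SwapEq o (v :: u :: p) q) :
    X.graph.Adj u v ∧ X.SwapEq o (u :: p) (u :: p) ∧ ∃ w q', q = v :: w :: q' := by
  cases h with
  | cons h h' => exact ⟨h, h'.left, _, _, rfl⟩
  | sq h h₁ h₂ => exact ⟨h.ab.symm, h₁.left, _, _, rfl⟩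

/-- If three last edges are involved, the squares exchanging them in pairs either share an
opposite corner or are completed to a 3-cube by the flag condition. -/
theorem trans_aux (hX : ∀ v, X.FlagLink v) (n : ℕ) : ∀ p q r : List V, p.length ≤ n →
    X.SwapEq o p q → X.SwapEq o q r → X.SwapEq o p r := by
  induction n with
  | zero =>
    intro p q r hp h₁ _
    obtain ⟨v, p', rfl⟩ := h₁.exists_cons
    simp at hp
  | succ n ih =>
    intro p q r hp h₁ h₂
    cases h₁ with
    | base => exact h₂
    | @cons v u p q hadj h =>
      simp only [List.length_cons, Nat.add_le_add_iff_right] at hp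
      obtain ⟨-, -, w, q', rfl⟩ := h₂.inv_left
      rcases h₂.inv with ⟨rfl, h'⟩ | ⟨x, m, hs, h', h''⟩
      · exact cons hadj (ih _ _ _ hp h h')
      · exact sq hs (ih _ _ _ hp h h') h''
    | @sq v u w x p q m hs h h' =>
      have l₁ := h.length_eq
      have l₂ := h'.length_eq
      simp only [List.length_cons, Nat.add_le_add_iff_right] at hp l₁ l₂
      obtain ⟨-, -, z, q', rfl⟩ := h₂.inv_left
      rcases h₂.inv with ⟨rfl, h₃⟩ | ⟨y, m', hs', h₃, h₄⟩
      · refine sq hs h (ih _ _ _ ?_ h₃.symm h')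
        have l₃ := h₃.length_eq
        simp only [List.length_cons] at l₃ ⊢
        omega
      · have l₃ := h₃.length_eq
        have l₄ := h₄.length_eq
        simp only [List.length_cons] at l₃ l₄
        have hw := ih _ _ _ (by simp only [List.length_cons]; omega) h'.symm h₃
        rcases hw.inv with ⟨rfl, h₅⟩ | ⟨t, k, hs₂, h₅, h₆⟩
        · obtain rfl : u = z := hs.rotate.rotate.rotate.unique hs'.reflect.rotate.rotate.rotate
          refine cons hs.ab.symm (ih _ _ _ hp h (ih _ _ _ ?_ (cons hs.bc.symm h₅) h₄.symm))
          simp only [List.length_cons]; omega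
        · have l₅ := h₅.length_eq
          have l₆ := h₆.length_eq
          simp only [List.length_cons] at l₅ l₆
          obtain ⟨s, s₁, s₂, s₃⟩ := exists_three_cube (hX w) hs.rotate.rotate.rotate
            hs'.reflect.rotate.rotate.rotate hs₂
          have ht : X.SwapEq o (t :: k) (t :: k) := h₅.right.inv_left.2.1
          refine sq s₁ (r := t :: k) ?_ ?_
          · refine ih _ _ _ hp h (ih _ _ _ ?_ (cons hs.bc.symm h₅) ?_)
            · simp only [List.length_cons]; omega
            · exact sq s₂.reflect.rotate.rotate.rotate h₅.right (cons s₂.cd.symm ht)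
          · refine ih _ _ _ ?_ h₄ (ih _ _ _ ?_ (cons hs'.cd h₆) ?_)
            · simp only [List.length_cons]; omega
            · simp only [List.length_cons]; omega
            · exact sq s₃.reflect.rotate.rotate.rotate h₆.right (cons s₃.cd.symm ht)

theorem trans (hX : ∀ v, X.FlagLink v) (h : X.SwapEq o p q) (h' : X.SwapEq o q r) :
    X.SwapEq o p r :=
  trans_aux hX _ _ _ _ le_rfl h h'

end SwapEq

/-- A path is reduced if no initial piece of it is swap equivalent to a path after which the next
edge backtracks. -/
def Reduced (X : CubeComplex V) (o : V) : List V → Prop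
  | [] => False
  | [v] => v = o
  | v :: u :: p => Reduced X o (u :: p) ∧ X.graph.Adj u v ∧ ¬ ∃ q, X.SwapEq o (u :: p) (u :: v :: q)

namespace Reduced

variable {o : V} {p q : List V}

theorem swapEq (h : X.Reduced o p) : X.SwapEq o p p := by
  induction p with
  | nil => exact h.elim
  | cons v p ih =>
    cases p with
    | nil => obtain rfl : v = o := h; exact .base
    | cons u p => exact .cons h.2.1 (ih h.1)

theorem congr_aux (hX : ∀ v, X.FlagLink v) (n : ℕ) : ∀ p q : List V, p.length ≤ n →
    X.SwapEq o p q → X.Reduced o p → X.Reduced o q := by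
  induction n with
  | zero =>
    intro p q hp h₁ _
    obtain ⟨v, p', rfl⟩ := h₁.exists_cons
    simp at hp
  | succ n ih =>
    intro p q hp h hr
    cases h with
    | base => exact hr
    | @cons v u p q hadj h =>
      simp only [List.length_cons, Nat.add_le_add_iff_right] at hp
      exact ⟨ih (u :: p) _ hp h hr.1, hadj, fun ⟨m, hm⟩ => hr.2.2 ⟨m, h.trans hX hm⟩⟩
    | @sq v u w x p q r hs h h' =>
      have l₁ := h.length_eq
      have l₂ := h'.length_eq
      simp only [List.length_cons, Nat.add_le_add_iff_right] at hp l₁ l₂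
      have hu := ih (u :: p) _ hp h hr.1
      have hw : X.Reduced o (w :: x :: r) := by
        refine ⟨hu.1, hs.cd, fun ⟨m, hm⟩ => hr.2.2 ⟨w :: m, ?_⟩⟩
        refine h.trans hX ((SwapEq.cons hs.bc.symm hm).trans hX ?_)
        exact .sq hs.rotate hm.right (.cons hs.da hm.right.inv_left.2.1)
      refine ⟨ih _ _ ?_ h'.symm hw, hs.da, fun ⟨m, hm⟩ => ?_⟩
      · simp only [List.length_cons]; omega
      · rcases (h'.symm.trans hX hm).inv with ⟨rfl, -⟩ | ⟨t, k, hs', h₁, -⟩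
        · exact hs.ac rfl
        · obtain rfl : u = t := hs.rotate.rotate.rotate.reflect.unique hs'
          exact hu.2.2 ⟨k, h₁⟩

theorem congr (hX : ∀ v, X.FlagLink v) (h : X.SwapEq o p q) (hr : X.Reduced o p) :
    X.Reduced o q :=
  congr_aux hX _ _ _ le_rfl h hr

end Reduced

/-- The result of continuing the reduced path `p` along an edge is, up to swaps, the reduced path
`q`: either `q` is `p` with the edge added, or the edge cancels against the last edge of `p`. -/
def Step (X : CubeComplex V) (o : V) (p q : List V) : Prop :=
  X.Reduced o p ∧ X.Reduced o q ∧ ((∃ v, X.SwapEq o (v :: p) q) ∨ ∃ u, X.SwapEq o (u :: q) p)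

namespace Step

variable {o : V} {p p' q q' : List V}

theorem symm (h : X.Step o p q) : X.Step o q p := ⟨h.2.1, h.1, h.2.2.symm⟩

theorem congr_right (hX : ∀ v, X.FlagLink v) (h : X.Step o p q) (hq : X.SwapEq o q q') :
    X.Step o p q' := by
  refine ⟨h.1, h.2.1.congr hX hq, h.2.2.imp (fun ⟨v, hv⟩ => ⟨v, hv.trans hX hq⟩)
    fun ⟨u, hu⟩ => ⟨u, ?_⟩⟩
  obtain ⟨v, r, rfl⟩ := hq.exists_cons
  obtain ⟨w, r', rfl⟩ := hq.symm.exists_cons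
  obtain rfl : v = w := by simpa using hq.head_eq
  exact (SwapEq.cons hu.inv_left.1 hq.symm).trans hX hu

theorem congr_left (hX : ∀ v, X.FlagLink v) (h : X.Step o p q) (hp : X.SwapEq o p p') :
    X.Step o p' q :=
  (h.symm.congr_right hX hp).symm

theorem functional (hX : ∀ v, X.FlagLink v) (h : X.Step o p q) (h' : X.Step o p q')
    (hv : q.head? = q'.head?) : X.SwapEq o q q' := by
  have mixed : ∀ {q q' : List V}, q.head? = q'.head? → X.Reduced o q →
      (∃ v, X.SwapEq o (v :: p) q) → (∃ u, X.SwapEq o (u :: q') p) → False := by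
    rintro q q' hv hq ⟨v, hv'⟩ ⟨u, hu⟩
    obtain ⟨a, r, rfl⟩ := hu.symm.exists_cons
    obtain ⟨b, r', rfl⟩ := hv'.symm.exists_cons
    obtain rfl : u = a := by simpa using hu.head_eq
    obtain rfl : v = b := by simpa using hv'.head_eq
    cases q' with
    | nil => simp at hv
    | cons c m =>
      obtain rfl : v = c := by simpa using hv
      exact (hq.congr hX hv'.symm).2.2 ⟨m, hu.symm⟩
  obtain ⟨-, hq, h⟩ := h
  obtain ⟨-, hq', h'⟩ := h'
  rcases h with ⟨v, h⟩ | ⟨u, h⟩ <;> rcases h' with ⟨v', h'⟩ | ⟨u', h'⟩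
  · have e₁ := h.head_eq
    have e₂ := h'.head_eq
    obtain rfl : v = v' := by simpa using e₁.trans (hv.trans e₂.symm)
    exact h.symm.trans hX h'
  · exact (mixed hv hq ⟨_, h⟩ ⟨_, h'⟩).elim
  · exact (mixed hv.symm hq' ⟨_, h'⟩ ⟨_, h⟩).elim
  · obtain rfl : u = u' := by simpa using h.head_eq.trans h'.head_eq.symm
    cases q with
    | nil => exact hq.elim
    | cons v r =>
      cases q' with
      | nil => exact hq'.elim
      | cons v' r' =>
        obtain rfl : v = v' := by simpa using hv
        rcases (h.trans hX h'.symm).inv with ⟨-, h⟩ | ⟨x, r, hs, -⟩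
        · exact h
        · exact absurd rfl hs.bd

theorem of_swapEq (hX : ∀ v, X.FlagLink v) {u v : V} (hp : X.Reduced o p)
    (h : X.SwapEq o p (u :: v :: q)) : X.Step o p (v :: q) :=
  ⟨hp, (hp.congr hX h).1, Or.inr ⟨u, h.symm⟩⟩

theorem cons {u v : V} (hp : X.Reduced o (v :: u :: p)) : X.Step o (u :: p) (v :: u :: p) :=
  ⟨hp.1, hp, Or.inl ⟨v, hp.swapEq⟩⟩

theorem total (hX : ∀ v, X.FlagLink v) {u v : V} (hp : X.Reduced o (u :: p))
    (hadj : X.graph.Adj u v) : ∃ q, X.Step o (u :: p) (v :: q) := by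
  by_cases h : ∃ q, X.SwapEq o (u :: p) (u :: v :: q)
  · obtain ⟨q, hq⟩ := h
    exact ⟨q, of_swapEq hX hp hq⟩
  · exact ⟨u :: p, cons ⟨hp, hadj, h⟩⟩

/-- The case of `Step.square` in which exactly one of the two edges at `a` cancels. -/
theorem square_mixed (hX : ∀ v, X.FlagLink v) {a b c d : V} (hs : X.Sq a b c d)
    (hp : X.Reduced o (a :: p)) (hb : ∃ q, X.SwapEq o (a :: p) (a :: b :: q))
    (hd : ¬ ∃ q, X.SwapEq o (a :: p) (a :: d :: q)) :
    ∃ rb rd q, X.Step o (a :: p) (b :: rb) ∧ X.Step o (b :: rb) (c :: q) ∧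
      X.Step o (a :: p) (d :: rd) ∧ X.Step o (d :: rd) (c :: q) := by
  obtain ⟨β, hβ⟩ := hb
  have hrb : X.Reduced o (b :: β) := (hp.congr hX hβ).1
  have hrd : X.Reduced o (d :: a :: p) := ⟨hp, hs.da.symm, hd⟩
  have hq : X.Reduced o (c :: b :: β) := by
    refine ⟨hrb, hs.bc, fun ⟨m, hm⟩ => hd ⟨c :: m, ?_⟩⟩
    refine hβ.trans hX (.sq hs hm (.cons hs.cd ?_))
    exact hm.right.inv_left.2.1
  refine ⟨β, a :: p, b :: β, of_swapEq hX hp hβ, cons hq, cons hrd, hrd, hq, Or.inr ⟨d, ?_⟩⟩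
  refine ((SwapEq.cons hs.da.symm hβ).trans hX ?_).symm
  exact .sq hs.rotate.rotate.rotate hβ.right hq.swapEq

/-- Going around a square does not change a reduced path, up to swaps. -/
theorem square (hX : ∀ v, X.FlagLink v) {a b c d : V} (hs : X.Sq a b c d)
    (hp : X.Reduced o (a :: p)) :
    ∃ rb rd q, X.Step o (a :: p) (b :: rb) ∧ X.Step o (b :: rb) (c :: q) ∧
      X.Step o (a :: p) (d :: rd) ∧ X.Step o (d :: rd) (c :: q) := by
  by_cases hb : ∃ q, X.SwapEq o (a :: p) (a :: b :: q) <;>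
    by_cases hd : ∃ q, X.SwapEq o (a :: p) (a :: d :: q)
  · obtain ⟨β, hβ⟩ := hb
    obtain ⟨δ, hδ⟩ := hd
    rcases (hβ.symm.trans hX hδ).inv with ⟨rfl, -⟩ | ⟨x, r, hs', h₁, h₂⟩
    · exact absurd rfl hs.bd
    · obtain rfl := hs'.unique hs
      have e₁ := hβ.trans hX (.cons hs.ab.symm h₁)
      have e₂ := hδ.trans hX (.cons hs.da h₂)
      have r₁ := (hp.congr hX e₁).1
      have r₂ := (hp.congr hX e₂).1
      exact ⟨x :: r, x :: r, r, of_swapEq hX hp e₁, of_swapEq hX r₁ r₁.swapEq,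
        of_swapEq hX hp e₂, of_swapEq hX r₂ r₂.swapEq⟩
  · exact square_mixed hX hs hp hb hd
  · obtain ⟨rd, rb, q, h₁, h₂, h₃, h₄⟩ := square_mixed hX hs.reflect hp hd hb
    exact ⟨rb, rd, q, h₃, h₄, h₁, h₂⟩
  · have hrb : X.Reduced o (b :: a :: p) := ⟨hp, hs.ab, hb⟩
    have hrd : X.Reduced o (d :: a :: p) := ⟨hp, hs.da.symm, hd⟩
    have hq : X.Reduced o (c :: b :: a :: p) := by
      refine ⟨hrb, hs.bc, fun ⟨m, hm⟩ => ?_⟩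
      rcases hm.inv with ⟨rfl, -⟩ | ⟨t, r, hs', h₁, -⟩
      · exact hs.ac rfl
      · obtain rfl : d = t := hs.rotate.reflect.unique hs'
        exact hd ⟨r, h₁⟩
    refine ⟨a :: p, a :: p, b :: a :: p, cons hrb, cons hq, cons hrd, hrd, hq,
      Or.inl ⟨c, ?_⟩⟩
    exact .sq hs.rotate.rotate hrd.swapEq hrb.swapEq

end Step

/-- Holonomy: starting from the reduced path `p`, following the given walk leads to the reduced
path `q`. -/
def Lift (X : CubeComplex V) (o : V) :
    ∀ {u v : V}, X.graph.Walk u v → List V → List V → Prop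
  | u, _, .nil, p, q => X.Reduced o p ∧ p.head? = some u ∧ X.SwapEq o p q
  | u, _, .cons (v := v) _ w, p, q =>
      ∃ r, p.head? = some u ∧ r.head? = some v ∧ X.Step o p r ∧ Lift X o w r q

namespace Lift

variable {o : V}

theorem reduced {u v : V} {w : X.graph.Walk u v} {p q : List V} (h : X.Lift o w p q) :
    X.Reduced o p ∧ p.head? = some u := by
  cases w with
  | nil => exact ⟨h.1, h.2.1⟩
  | cons _ w => obtain ⟨r, h₁, -, h₂, -⟩ := h; exact ⟨h₂.1, h₁⟩

theorem congr_left (hX : ∀ v, X.FlagLink v) {u v : V} {w : X.graph.Walk u v}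
    {p p' q : List V} (h : X.Lift o w p q) (hp : X.SwapEq o p p') : X.Lift o w p' q := by
  cases w with
  | nil => exact ⟨h.1.congr hX hp, hp.head_eq ▸ h.2.1, hp.symm.trans hX h.2.2⟩
  | cons _ w =>
    obtain ⟨r, h₁, h₂, h₃, h₄⟩ := h
    exact ⟨r, hp.head_eq ▸ h₁, h₂, h₃.congr_left hX hp, h₄⟩

theorem functional (hX : ∀ v, X.FlagLink v) {u v : V} {w : X.graph.Walk u v}
    {p q q' : List V} (h : X.Lift o w p q) (h' : X.Lift o w p q') : X.SwapEq o q q' := by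
  induction w generalizing p with
  | nil => exact h.2.2.symm.trans hX h'.2.2
  | cons _ w ih =>
    obtain ⟨r, -, h₂, h₃, h₄⟩ := h
    obtain ⟨r', -, h₂', h₃', h₄'⟩ := h'
    exact ih (h₄.congr_left hX (h₃.functional hX h₃' (h₂.trans h₂'.symm))) h₄'

theorem append (hX : ∀ v, X.FlagLink v) {u v z : V} {w : X.graph.Walk u v}
    {w' : X.graph.Walk v z} {p q : List V} :
    X.Lift o (w.append w') p q ↔ ∃ r, X.Lift o w p r ∧ X.Lift o w' r q := by
  induction w generalizing p with
  | nil =>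
    constructor
    · intro h
      exact ⟨p, ⟨h.reduced.1, h.reduced.2, h.reduced.1.swapEq⟩, h⟩
    · rintro ⟨r, ⟨-, -, h⟩, h'⟩
      exact h'.congr_left hX h.symm
  | cons _ w ih =>
    constructor
    · rintro ⟨r, h₁, h₂, h₃, h₄⟩
      obtain ⟨s, h₅, h₆⟩ := ih.1 h₄
      exact ⟨s, ⟨r, h₁, h₂, h₃, h₅⟩, h₆⟩
    · rintro ⟨s, ⟨r, h₁, h₂, h₃, h₅⟩, h₆⟩
      exact ⟨r, h₁, h₂, h₃, ih.2 ⟨s, h₅, h₆⟩⟩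

theorem of_square (hX : ∀ v, X.FlagLink v) {a b c d : V} (hs : X.Sq a b c d) {p q : List V}
    (h : X.Lift o (.cons hs.ab (.cons hs.bc .nil)) p q) :
    X.Lift o (.cons hs.da.symm (.cons hs.cd.symm .nil)) p q := by
  obtain ⟨r₁, ha, hb, h₁, r₂, -, hc, h₂, -, -, h₃⟩ := h
  cases p with
  | nil => simp at ha
  | cons a' p =>
    obtain rfl : a' = a := by simpa using ha
    obtain ⟨rb, rd, m, s₁, s₂, s₃, s₄⟩ := Step.square hX hs h₁.1
    have e₁ := s₁.functional hX h₁ (by simp [hb])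
    have e₂ := (s₂.congr_left hX e₁).functional hX h₂ (by simp [hc])
    exact ⟨_, ha, rfl, s₃, _, rfl, rfl, s₄, s₄.2.1, rfl, e₂.trans hX h₃⟩

theorem homotopic (hX : ∀ v, X.FlagLink v) {u v : V} {w w' : X.graph.Walk u v}
    (h : X.Homotopic w w') (p q : List V) : X.Lift o w p q ↔ X.Lift o w' p q := by
  induction h generalizing p q with
  | refl => exact Iff.rfl
  | symm _ ih => exact (ih p q).symm
  | trans _ _ ih₁ ih₂ => exact (ih₁ p q).trans (ih₂ p q)
  | append _ _ ih₁ ih₂ =>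
    rw [append hX, append hX]
    exact exists_congr fun r => and_congr (ih₁ p r) (ih₂ r q)
  | @backtrack u v hadj =>
    constructor
    · rintro ⟨r, h₁, h₂, h₃, r', -, h₄, h₅, -, -, h₆⟩
      exact ⟨h₃.1, h₁, (h₃.symm.functional hX h₅ (h₁.trans h₄.symm)).trans hX h₆⟩
    · rintro ⟨h₁, h₂, h₃⟩
      cases p with
      | nil => simp at h₂
      | cons u' p =>
        obtain rfl : u' = u := by simpa using h₂
        obtain ⟨r, hr⟩ := Step.total hX h₁ hadj
        exact ⟨_, rfl, rfl, hr, _, rfl, rfl, hr.symm, h₁, rfl, h₃⟩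
  | @square a b c d hab hbc had hdc hs =>
    by_cases hbd : b = d
    · subst hbd; exact Iff.rfl
    · have hsq := Sq.of_mem hab had hs hbd
      exact ⟨of_square hX hsq, of_square hX hsq.reflect⟩

theorem exists_walk {v : V} {p : List V} (hX : ∀ v, X.FlagLink v) (hp : X.Reduced o p)
    (hv : p.head? = some v) : ∃ w : X.graph.Walk o v, X.Lift o w [o] p := by
  induction p generalizing v with
  | nil => exact hp.elim
  | cons v' p ih =>
    obtain rfl : v' = v := by simpa using hv
    cases p with
    | nil =>
      obtain rfl : v' = o := hp
      exact ⟨.nil, rfl, rfl, .base⟩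
    | cons u p =>
      obtain ⟨w, hw⟩ := ih hp.1 rfl
      exact ⟨w.append (.cons hp.2.1 .nil), (append hX).2
        ⟨_, hw, _, rfl, rfl, Step.cons hp, hp, rfl, hp.swapEq⟩⟩

end Lift

theorem IsSimplyConnected.homotopic (hX : X.IsSimplyConnected) {u v : V}
    (p q : X.graph.Walk u v) : X.Homotopic p q := by
  have h₁ : X.Homotopic (p.append (q.reverse.append q)) (p.append .nil) :=
    .append (.refl p) (hX.2 _ _)
  have h₂ : X.Homotopic ((p.append q.reverse).append q) (SimpleGraph.Walk.nil.append q) :=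
    .append (hX.2 _ _) (.refl q)
  rw [SimpleGraph.Walk.append_nil] at h₁
  rw [SimpleGraph.Walk.nil_append, ← SimpleGraph.Walk.append_assoc] at h₂
  exact h₁.symm.trans h₂

/-- In a CAT(0) cube complex reduced paths with the same endpoints differ only by swaps. -/
theorem IsCAT0.swapEq_of_reduced (hX : X.IsCAT0) {o : V} {p q : List V} (hp : X.Reduced o p)
    (hq : X.Reduced o q) (h : p.head? = q.head?) : X.SwapEq o p q := by
  cases p with
  | nil => exact hp.elim
  | cons v p =>
    obtain ⟨w, hw⟩ := Lift.exists_walk hX.2 hp rfl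
    obtain ⟨w', hw'⟩ := Lift.exists_walk hX.2 hq h.symm
    exact Lift.functional hX.2 ((Lift.homotopic hX.2 (hX.1.homotopic w w') _ _).1 hw) hw'

/-! ### Bipartiteness and the quadrangle condition -/

section Dist

variable {o : V} {p q : List V} {u v w : V}

/-- A path is at least as long as the distance of its endpoints. -/
theorem SwapEq.dist_lt (hX : X.IsCAT0) (h : X.SwapEq o (v :: p) q) :
    X.graph.dist o v < (v :: p).length := by
  induction p generalizing v q with
  | nil => cases h; simp
  | cons u p ih =>
    have := ih h.inv_left.2.1
    have h1 := hX.1.1.dist_triangle (u := o) (v := u) (w := v)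
    rw [SimpleGraph.dist_eq_one_iff_adj.2 h.inv_left.1] at h1
    simp only [List.length_cons] at this ⊢
    omega

theorem exists_path_length (hX : X.IsCAT0) (o v : V) :
    ∃ p, X.SwapEq o (v :: p) (v :: p) ∧ p.length = X.graph.dist o v := by
  obtain ⟨w, hw⟩ := hX.1.1.exists_walk_length_eq_dist v o
  rw [SimpleGraph.dist_comm, ← hw]
  clear hw
  induction w with
  | nil => exact ⟨[], .base, rfl⟩
  | cons h w ih =>
    obtain ⟨p, hp, hl⟩ := ih
    exact ⟨_, .cons h.symm hp, by simp [hl]⟩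

/-- Geodesics are reduced. -/
theorem SwapEq.reduced (hX : X.IsCAT0) (h : X.SwapEq o (v :: p) (v :: p))
    (hp : p.length = X.graph.dist o v) : X.Reduced o (v :: p) := by
  induction p generalizing v with
  | nil => cases h; exact rfl
  | cons u p ih =>
    have h₁ := h.inv_left.2.1
    have h₂ := h₁.dist_lt hX
    have h₃ := hX.1.1.dist_triangle (u := o) (v := u) (w := v)
    rw [SimpleGraph.dist_eq_one_iff_adj.2 h.inv_left.1] at h₃
    simp only [List.length_cons] at hp h₂
    refine ⟨ih h₁ (by omega), h.inv_left.1, fun ⟨q, hq⟩ => ?_⟩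
    have h₄ := hq.right.inv_left.2.1.dist_lt hX
    have h₅ := hq.length_eq
    simp only [List.length_cons] at h₄ h₅
    omega

theorem exists_reduced (hX : X.IsCAT0) (o v : V) :
    ∃ p, X.Reduced o (v :: p) ∧ p.length = X.graph.dist o v := by
  obtain ⟨p, hp, hl⟩ := exists_path_length hX o v
  exact ⟨p, hp.reduced hX hl, hl⟩

/-- Reduced paths are geodesics. -/
theorem Reduced.length_eq (hX : X.IsCAT0) (h : X.Reduced o (v :: p)) :
    p.length = X.graph.dist o v := by
  obtain ⟨q, hq, hl⟩ := exists_reduced hX o v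
  have := (hX.swapEq_of_reduced h hq rfl).length_eq
  simp only [List.length_cons] at this
  omega

/-- The 1-skeleton is bipartite. -/
theorem IsCAT0.dist_adj (hX : X.IsCAT0) (o : V) (h : X.graph.Adj u v) :
    X.graph.dist o v = X.graph.dist o u + 1 ∨ X.graph.dist o u = X.graph.dist o v + 1 := by
  obtain ⟨p, hp, hl⟩ := exists_reduced hX o u
  obtain ⟨q, -, hq, hpq⟩ := Step.total hX.2 hp h
  have hl' := hq.length_eq hX
  rcases hpq with ⟨_, h⟩ | ⟨_, h⟩ <;>
  · have := h.length_eq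
    simp only [List.length_cons] at this
    omega

/-- The quadrangle condition. -/
theorem IsCAT0.quadrangle (hX : X.IsCAT0) (o : V) (huv : X.graph.Adj v u) (hwv : X.graph.Adj v w)
    (hne : u ≠ w) (hu : X.graph.dist o v = X.graph.dist o u + 1)
    (hw : X.graph.dist o v = X.graph.dist o w + 1) :
    ∃ x, X.Sq v u x w ∧ X.graph.dist o u = X.graph.dist o x + 1 := by
  obtain ⟨p, hp, hlp⟩ := exists_path_length hX o u
  obtain ⟨q, hq, hlq⟩ := exists_path_length hX o w
  have hp' := (SwapEq.cons huv.symm hp).reduced hX (by simp only [List.length_cons]; omega)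
  have hq' := (SwapEq.cons hwv.symm hq).reduced hX (by simp only [List.length_cons]; omega)
  rcases (hX.swapEq_of_reduced hp' hq' rfl).inv with ⟨rfl, -⟩ | ⟨x, r, hs, h₁, -⟩
  · exact absurd rfl hne
  · refine ⟨x, hs, ?_⟩
    have h₂ := h₁.length_eq
    have h₃ := ((hp'.1.congr hX.2 h₁).1).length_eq hX
    simp only [List.length_cons] at h₂
    omega

end Dist

/-! ### Halfspaces -/

/-- The vertices closer to `a` than to `b`. -/
def side (X : CubeComplex V) (a b : V) : Set V := {x | X.graph.dist x a < X.graph.dist x b}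

/-- The halfspaces of `X`: the sets of vertices closer to one end of some edge than to the
other. -/
def IsHalf (X : CubeComplex V) (h : Set V) : Prop := ∃ a b, X.graph.Adj a b ∧ h = X.side a b

/-- The halfspaces containing `x` but not `y`. -/
def Sep (X : CubeComplex V) (x y : V) : Set (Set V) := {h | X.IsHalf h ∧ x ∈ h ∧ y ∉ h}

section Halfspaces

variable {a b c d x y z : V} {h : Set V}

theorem mem_side : x ∈ X.side a b ↔ X.graph.dist x a < X.graph.dist x b := Iff.rfl

theorem left_mem_side (hab : X.graph.Adj a b) : a ∈ X.side a b := by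
  rw [mem_side, SimpleGraph.dist_self, SimpleGraph.dist_eq_one_iff_adj.2 hab]
  exact one_pos

theorem right_notMem_side : b ∉ X.side a b := by
  simp [mem_side]

theorem notMem_side (hX : X.IsCAT0) (hab : X.graph.Adj a b) :
    x ∉ X.side a b ↔ x ∈ X.side b a := by
  rw [mem_side, mem_side]
  have := hX.dist_adj x hab
  omega

theorem compl_side (hX : X.IsCAT0) (hab : X.graph.Adj a b) : (X.side a b)ᶜ = X.side b a := by
  ext x; exact notMem_side hX hab

theorem IsHalf.compl (hX : X.IsCAT0) (hh : X.IsHalf h) : X.IsHalf hᶜ := by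
  obtain ⟨a, b, hab, rfl⟩ := hh
  exact ⟨b, a, hab.symm, compl_side hX hab⟩

theorem side_subset_of_sq (hX : X.IsCAT0) (hs : X.Sq a b c d) : X.side a b ⊆ X.side d c := by
  intro x hx
  by_contra hx'
  rw [mem_side] at hx hx'
  have h₁ := hX.dist_adj x hs.ab
  have h₂ := hX.dist_adj x hs.bc
  have h₃ := hX.dist_adj x hs.cd
  have h₄ := hX.dist_adj x hs.da
  obtain ⟨t, ht, hd⟩ := hX.quadrangle x hs.ab.symm hs.bc hs.ac (by omega) (by omega)
  obtain rfl : d = t := hs.reflect.rotate.rotate.rotate.unique ht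
  omega

/-- Opposite edges of a square bound the same halfspace. -/
theorem Sq.side_eq (hX : X.IsCAT0) (hs : X.Sq a b c d) : X.side a b = X.side d c :=
  (side_subset_of_sq hX hs).antisymm (side_subset_of_sq hX hs.reflect.rotate)

/-- An edge crossing the wall of `ab` is joined to `ab` by a chain of squares, successive edges of
the chain being opposite in a square. -/
theorem exists_square_chain (hX : X.IsCAT0) (hab : X.graph.Adj a b) (hxy : X.graph.Adj x y)
    (hx : x ∈ X.side a b) (hy : y ∉ X.side a b) :
    Relation.ReflTransGen (fun p q : V × V => X.Sq p.1 p.2 q.2 q.1) (x, y) (a, b) := by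
  induction hn : X.graph.dist a x generalizing x y with
  | zero =>
    obtain rfl := hX.1.1.dist_eq_zero_iff.1 hn
    rw [notMem_side hX hab, mem_side] at hy
    rw [SimpleGraph.dist_comm (u := y) (v := a), SimpleGraph.dist_eq_one_iff_adj.2 hxy] at hy
    obtain rfl := hX.1.1.dist_eq_zero_iff.1 (show X.graph.dist y b = 0 by omega)
    exact .refl
  | succ k ih =>
    rw [notMem_side hX hab, mem_side] at hy
    rw [mem_side] at hx
    have hxb := hX.dist_adj x hab
    have hyb := hX.dist_adj y hab
    have hay := hX.dist_adj a hxy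
    have hby := hX.dist_adj b hxy
    simp only [SimpleGraph.dist_comm (u := x), SimpleGraph.dist_comm (u := y)] at *
    obtain ⟨x', hxx', hx'⟩ : ∃ x', X.graph.Adj x x' ∧ X.graph.dist a x' = k := by
      obtain ⟨w, hw⟩ := hX.1.1.exists_walk_length_eq_dist x a
      rw [SimpleGraph.dist_comm, hn] at hw
      cases w with
      | nil => simp at hw
      | @cons _ x' _ h w =>
        refine ⟨x', h, ?_⟩
        rw [SimpleGraph.Walk.length_cons] at hw
        have h₁ := SimpleGraph.dist_le w
        have h₂ := hX.dist_adj a h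
        rw [SimpleGraph.dist_comm] at h₁
        omega
    have hx'b := hX.dist_adj x' hab
    simp only [SimpleGraph.dist_comm (u := x')] at hx'b
    have hbx' := hX.dist_adj b hxx'
    have hne : y ≠ x' := by rintro rfl; omega
    obtain ⟨t, ht, hdt⟩ := hX.quadrangle b hxy hxx' hne (by omega) (by omega)
    have hta := hX.dist_adj a ht.bc
    have htb := hX.dist_adj t hab
    simp only [SimpleGraph.dist_comm (u := t)] at htb
    refine .head (show X.Sq x y t x' from ht) (ih ht.cd.symm ?_ ?_ hx')
    · rw [mem_side, SimpleGraph.dist_comm, SimpleGraph.dist_comm (u := x')]; omega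
    · rw [mem_side, SimpleGraph.dist_comm, SimpleGraph.dist_comm (u := t)]; omega

theorem side_eq_of_chain (hX : X.IsCAT0) {p q : V × V}
    (h : Relation.ReflTransGen (fun p q : V × V => X.Sq p.1 p.2 q.2 q.1) p q) :
    X.side p.1 p.2 = X.side q.1 q.2 := by
  induction h with
  | refl => rfl
  | tail _ hs ih => exact ih.trans (Sq.side_eq hX hs)

theorem IsHalf.eq_side (hX : X.IsCAT0) (hh : X.IsHalf h) (hxy : X.graph.Adj x y) (hx : x ∈ h)
    (hy : y ∉ h) : h = X.side x y := by
  obtain ⟨a, b, hab, rfl⟩ := hh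
  exact (side_eq_of_chain hX (exists_square_chain hX hab hxy hx hy)).symm

theorem exists_adj_dist (hX : X.IsCAT0) {n : ℕ} (hn : X.graph.dist x y = n + 1) :
    ∃ z, X.graph.Adj z y ∧ X.graph.dist x z = n := by
  obtain ⟨w, hw⟩ := hX.1.1.exists_walk_length_eq_dist y x
  rw [SimpleGraph.dist_comm, hn] at hw
  cases w with
  | nil => simp at hw
  | @cons _ z _ h w =>
    refine ⟨z, h.symm, ?_⟩
    rw [SimpleGraph.Walk.length_cons] at hw
    have h₁ := SimpleGraph.dist_le w
    have h₂ := hX.dist_adj x h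
    rw [SimpleGraph.dist_comm] at h₁
    omega

theorem sep_finite_and_ncard (hX : X.IsCAT0) (x y : V) :
    (X.Sep x y).Finite ∧ (X.Sep x y).ncard = X.graph.dist x y := by
  induction hn : X.graph.dist x y generalizing y with
  | zero =>
    obtain rfl := hX.1.1.dist_eq_zero_iff.1 hn
    have : X.Sep x x = ∅ := by ext h; simp only [Sep]; simp
    rw [this]; simp
  | succ n ih =>
    obtain ⟨z, hz, hxz⟩ := exists_adj_dist hX hn
    have he : X.Sep x y = insert (X.side z y) (X.Sep x z) := by
      ext h
      constructor
      · rintro ⟨hh, hx, hy⟩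
        by_cases hzh : z ∈ h
        · exact Or.inl (hh.eq_side hX hz hzh hy)
        · exact Or.inr ⟨hh, hx, hzh⟩
      · rintro (rfl | ⟨hh, hx, hzh⟩)
        · exact ⟨⟨z, y, hz, rfl⟩, by rw [mem_side]; omega, right_notMem_side⟩
        · refine ⟨hh, hx, fun hy => ?_⟩
          obtain rfl := hh.eq_side hX hz.symm hy hzh
          rw [mem_side] at hx
          omega
    have hnot : X.side z y ∉ X.Sep x z := fun h => h.2.2 (left_mem_side hz)
    obtain ⟨hf, hc⟩ := ih z hxz
    rw [he, Set.ncard_insert_of_notMem hnot hf, hc]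
    exact ⟨hf.insert _, rfl⟩

theorem sep_finite (hX : X.IsCAT0) (x y : V) : (X.Sep x y).Finite := (sep_finite_and_ncard hX x y).1

/-- The distance of two vertices is the number of halfspaces containing the first but not the
second, that is, the number of hyperplanes separating them. -/
theorem ncard_sep (hX : X.IsCAT0) (x y : V) : (X.Sep x y).ncard = X.graph.dist x y :=
  (sep_finite_and_ncard hX x y).2

theorem exists_sep (hX : X.IsCAT0) (hxy : x ≠ y) : ∃ h, X.IsHalf h ∧ x ∈ h ∧ y ∉ h := by
  have h := hX.1.1.pos_dist_of_ne hxy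
  rw [← ncard_sep hX, Set.ncard_pos (sep_finite hX x y)] at h
  exact h

theorem sep_eq_singleton_iff (hX : X.IsCAT0) :
    X.Sep x y = {h} ↔ X.graph.Adj x y ∧ h = X.side x y := by
  constructor
  · intro hs
    have hadj : X.graph.Adj x y := by
      rw [← SimpleGraph.dist_eq_one_iff_adj, ← ncard_sep hX, hs, Set.ncard_singleton]
    have hh : h ∈ X.Sep x y := hs ▸ rfl
    exact ⟨hadj, hh.1.eq_side hX hadj hh.2.1 hh.2.2⟩
  · rintro ⟨hadj, rfl⟩
    refine Set.eq_singleton_iff_unique_mem.2 ⟨⟨⟨x, y, hadj, rfl⟩, left_mem_side hadj,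
      right_notMem_side⟩, fun k hk => hk.1.eq_side hX hadj hk.2.1 hk.2.2⟩

/-- A set of vertices is convex if it is nonempty and contains the geodesics between its
members. -/
structure IsConvexSet (X : CubeComplex V) (S : Set V) : Prop where
  nonempty : S.Nonempty
  mem : ∀ x ∈ S, ∀ y ∈ S, ∀ z, X.graph.dist x z + X.graph.dist z y = X.graph.dist x y → z ∈ S

theorem IsHalf.isConvexSet (hX : X.IsCAT0) (hh : X.IsHalf h) : X.IsConvexSet h := by
  constructor
  · obtain ⟨a, b, hab, rfl⟩ := hh
    exact ⟨a, left_mem_side hab⟩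
  · intro x hx y hy z hz
    by_contra hzh
    rw [← ncard_sep hX, ← ncard_sep hX, ← ncard_sep hX] at hz
    have hmem : h ∈ X.Sep x z := ⟨hh, hx, hzh⟩
    have hsub : X.Sep x y ⊆ (X.Sep x z \ {h}) ∪ X.Sep z y := by
      rintro k ⟨hk, hxk, hyk⟩
      by_cases hzk : z ∈ k
      · exact Or.inr ⟨hk, hzk, hyk⟩
      · exact Or.inl ⟨⟨hk, hxk, hzk⟩, by rintro rfl; exact hyk hy⟩
    have h₁ := Set.ncard_le_ncard hsub (((sep_finite hX x z).sdiff).union (sep_finite hX z y))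
    have h₂ := Set.ncard_union_le (X.Sep x z \ {h}) (X.Sep z y)
    have h₃ := Set.ncard_sdiff_singleton_lt_of_mem hmem (sep_finite hX x z)
    omega

theorem IsConvexSet.inter {S T : Set V} (hS : X.IsConvexSet S) (hT : X.IsConvexSet T)
    (hST : (S ∩ T).Nonempty) : X.IsConvexSet (S ∩ T) :=
  ⟨hST, fun x hx y hy z hz => ⟨hS.mem x hx.1 y hy.1 z hz, hT.mem x hx.2 y hy.2 z hz⟩⟩

end Halfspaces

/-! ### Gates, crossing halfspaces and orthogonality -/

section Gates

variable {a b x y z v : V} {h k : Set V} {S T : Set V} {U : Set (Set V)}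

/-- Every vertex has a gate in every convex set. -/
theorem IsConvexSet.exists_gate (hX : X.IsCAT0) (hS : X.IsConvexSet S) (v : V) :
    ∃ y ∈ S, ∀ z ∈ S, X.graph.dist v z = X.graph.dist v y + X.graph.dist y z := by
  classical
  obtain ⟨y, hy, hmin⟩ : ∃ y ∈ S, ∀ z ∈ S, X.graph.dist v y ≤ X.graph.dist v z := by
    have hex : ∃ n, ∃ y ∈ S, X.graph.dist v y = n := ⟨_, _, hS.nonempty.some_mem, rfl⟩
    obtain ⟨y, hy, hd⟩ := Nat.find_spec hex
    exact ⟨y, hy, fun z hz => hd ▸ Nat.find_min' hex ⟨z, hz, rfl⟩⟩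
  refine ⟨y, hy, fun z hz => ?_⟩
  induction hn : X.graph.dist y z using Nat.strong_induction_on generalizing z with
  | _ n ih =>
    cases n with
    | zero => rw [← hX.1.1.dist_eq_zero_iff.1 hn, add_zero]
    | succ n =>
      obtain ⟨z', hz', hyz'⟩ := exists_adj_dist hX hn
      have hz'S : z' ∈ S := hS.mem y hy z hz z' (by
        rw [SimpleGraph.dist_eq_one_iff_adj.2 hz']; omega)
      have h₁ := ih n (by omega) z' hz'S hyz'
      have h₂ := hX.dist_adj v hz'
      rcases h₂ with h₂ | h₂
      · omega
      exfalso
      cases n with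
      | zero =>
        have := hmin z hz
        omega
      | succ n =>
        obtain ⟨z'', hz'', hyz''⟩ := exists_adj_dist hX hyz'
        have hz''S : z'' ∈ S := hS.mem y hy z' hz'S z'' (by
          rw [SimpleGraph.dist_eq_one_iff_adj.2 hz'']; omega)
        have h₃ := ih n (by omega) z'' hz''S hyz''
        have hne : z'' ≠ z := by rintro rfl; omega
        obtain ⟨t, ht, hdt⟩ := hX.quadrangle v hz''.symm hz' hne (by omega) (by omega)
        have h₄ := hX.dist_adj y ht.bc
        have h₅ := hX.dist_adj y ht.cd
        have htS : t ∈ S := hS.mem z'' hz''S z hz t (by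
          have h₆ := hX.1.1.dist_triangle (u := y) (v := z'') (w := z)
          have h₇ := hX.1.1.dist_triangle (u := z'') (v := t) (w := z)
          rw [SimpleGraph.dist_eq_one_iff_adj.2 ht.bc,
            SimpleGraph.dist_eq_one_iff_adj.2 ht.cd] at *
          omega)
        have h₆ := ih (n + 1) (by omega) t htS (by omega)
        omega

open Classical in
/-- The gate of the vertex `v` in the set `S` (and `v` itself if there is none). -/
noncomputable def gate (X : CubeComplex V) (S : Set V) (v : V) : V :=
  if h : ∃ y ∈ S, ∀ z ∈ S, X.graph.dist v z = X.graph.dist v y + X.graph.dist y z then h.choose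
  else v

theorem IsConvexSet.gate_spec (hX : X.IsCAT0) (hS : X.IsConvexSet S) (v : V) : X.gate S v ∈ S ∧
    ∀ z ∈ S, X.graph.dist v z = X.graph.dist v (X.gate S v) + X.graph.dist (X.gate S v) z := by
  have h := hS.exists_gate hX v
  rw [gate, dif_pos h]
  exact h.choose_spec

theorem IsConvexSet.gate_mem (hX : X.IsCAT0) (hS : X.IsConvexSet S) (v : V) : X.gate S v ∈ S :=
  (hS.gate_spec hX v).1

/-- A halfspace separating a vertex from its gate in `S` separates it from `S`. -/
theorem IsConvexSet.notMem_of_gate (hX : X.IsCAT0) (hS : X.IsConvexSet S) (hh : X.IsHalf h)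
    (hv : v ∈ h) (hg : X.gate S v ∉ h) (hz : z ∈ S) : z ∉ h := fun hzh =>
  hg ((hh.isConvexSet hX).mem v hv z hzh _ ((hS.gate_spec hX v).2 z hz).symm)

/-- The halfspaces crossed by `S`, that is, those which contain some but not all of `S`. -/
def Cross (X : CubeComplex V) (S : Set V) : Set (Set V) :=
  {h | X.IsHalf h ∧ (∃ x ∈ S, x ∈ h) ∧ ∃ y ∈ S, y ∉ h}

theorem cross_compl (hX : X.IsCAT0) (hh : h ∈ X.Cross S) : hᶜ ∈ X.Cross S := by
  obtain ⟨hh, hx, y, hy, hyh⟩ := hh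
  exact ⟨hh.compl hX, ⟨y, hy, hyh⟩, hx.imp fun x hx => ⟨hx.1, fun h => h hx.2⟩⟩

theorem mem_cross_of_sep (hh : X.IsHalf h) (hx : x ∈ S) (hy : y ∈ S)
    (hxy : ¬ (x ∈ h ↔ y ∈ h)) : h ∈ X.Cross S := by
  by_cases hxh : x ∈ h
  · exact ⟨hh, ⟨x, hx, hxh⟩, y, hy, fun h => hxy (iff_of_true hxh h)⟩
  · exact ⟨hh, ⟨y, hy, by tauto⟩, x, hx, hxh⟩

theorem cross_mono (h : S ⊆ T) : X.Cross S ⊆ X.Cross T :=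
  fun _ ⟨hh, ⟨x, hx, hxh⟩, y, hy, hyh⟩ => ⟨hh, ⟨x, h hx, hxh⟩, y, h hy, hyh⟩

theorem IsConvexSet.gate_mem_iff (hX : X.IsCAT0) (hS : X.IsConvexSet S) (hh : h ∈ X.Cross S)
    (v : V) : X.gate S v ∈ h ↔ v ∈ h := by
  obtain ⟨hh, ⟨x, hx, hxh⟩, y, hy, hyh⟩ := hh
  constructor
  · intro hg
    by_contra hv
    exact hS.notMem_of_gate hX (hh.compl hX) (v := v) hv (fun h => h hg) hy hyh
  · intro hv
    by_contra hg
    exact hS.notMem_of_gate hX hh hv hg hx hxh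

/-- Two halfspaces are transverse, that is, the hyperplanes bounding them cross, if both and
their complements meet in all four ways. -/
structure Transverse (h k : Set V) : Prop where
  pp : (h ∩ k).Nonempty
  pn : (h ∩ kᶜ).Nonempty
  np : (hᶜ ∩ k).Nonempty
  nn : (hᶜ ∩ kᶜ).Nonempty

theorem Transverse.symm (h₁ : Transverse h k) : Transverse k h := by
  refine ⟨?_, ?_, ?_, ?_⟩ <;> rw [Set.inter_comm]
  exacts [h₁.pp, h₁.np, h₁.pn, h₁.nn]

theorem Transverse.compl_left (h₁ : Transverse h k) : Transverse hᶜ k :=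
  ⟨h₁.np, h₁.nn, by simpa using h₁.pp, by simpa using h₁.pn⟩

theorem Transverse.compl_right (h₁ : Transverse h k) : Transverse h kᶜ :=
  h₁.symm.compl_left.symm

theorem Transverse.irrefl (h₁ : Transverse h h) : False := by
  obtain ⟨x, hx, hx'⟩ := h₁.pn
  exact hx' hx

/-- The halfspaces transverse to all members of `U`. -/
def perp (X : CubeComplex V) (U : Set (Set V)) : Set (Set V) :=
  {h | X.IsHalf h ∧ ∀ k ∈ U, Transverse h k}

theorem perp_compl (hX : X.IsCAT0) (hh : h ∈ X.perp U) : hᶜ ∈ X.perp U :=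
  ⟨hh.1.compl hX, fun k hk => (hh.2 k hk).compl_left⟩

theorem perp_anti {U U' : Set (Set V)} (h : U ⊆ U') : X.perp U' ⊆ X.perp U :=
  fun _ hh => ⟨hh.1, fun k hk => hh.2 k (h hk)⟩

theorem subset_perp_perp (hU : ∀ h ∈ U, X.IsHalf h) : U ⊆ X.perp (X.perp U) :=
  fun h hh => ⟨hU h hh, fun _ hk => (hk.2 h hh).symm⟩

theorem perp_perp_perp (hU : ∀ h ∈ U, X.IsHalf h) : X.perp (X.perp (X.perp U)) = X.perp U :=
  (perp_anti (subset_perp_perp hU)).antisymm (subset_perp_perp fun _ hh => hh.1)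

theorem perp_union {U U' : Set (Set V)} : X.perp (U ∪ U') = X.perp U ∩ X.perp U' := by
  ext h
  constructor
  · exact fun hh => ⟨perp_anti Set.subset_union_left hh, perp_anti Set.subset_union_right hh⟩
  · rintro ⟨h₁, h₂⟩
    exact ⟨h₁.1, fun k hk => hk.elim (h₁.2 k) (h₂.2 k)⟩

theorem disjoint_perp (h₁ : h ∈ U) (h₂ : h ∈ X.perp U) : False := (h₂.2 h h₁).irrefl

/-- The vertices which are separated from `a` only by members of `U`. -/
def span (X : CubeComplex V) (a : V) (U : Set (Set V)) : Set V :=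
  {x | ∀ h, X.IsHalf h → ¬ (a ∈ h ↔ x ∈ h) → h ∈ U}

theorem self_mem_span : a ∈ X.span a U := fun _ _ h => absurd Iff.rfl h

theorem span_mono {U U' : Set (Set V)} (h : U ⊆ U') : X.span a U ⊆ X.span a U' :=
  fun _ hx k hk hs => h (hx k hk hs)

theorem span_isConvexSet (hX : X.IsCAT0) : X.IsConvexSet (X.span a U) := by
  refine ⟨⟨a, self_mem_span⟩, fun x hx y hy z hz h hh hs => ?_⟩
  by_cases h₁ : a ∈ h ↔ x ∈ h
  · by_cases h₂ : a ∈ h ↔ y ∈ h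
    · exfalso
      apply hs
      by_cases ha : a ∈ h
      · exact iff_of_true ha ((hh.isConvexSet hX).mem x (h₁.1 ha) y (h₂.1 ha) z hz)
      · exact iff_of_false ha (((hh.compl hX).isConvexSet hX).mem x (fun h => ha (h₁.2 h)) y
          (fun h => ha (h₂.2 h)) z hz)
    · exact hy h hh h₂
  · exact hx h hh h₁

theorem sep_mem_of_span (hx : x ∈ X.span a U) (hy : y ∈ X.span a U) (hh : X.IsHalf h)
    (hs : ¬ (x ∈ h ↔ y ∈ h)) : h ∈ U := by
  by_cases h₁ : a ∈ h ↔ x ∈ h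
  · exact hy h hh (fun h₂ => hs (h₁.symm.trans h₂))
  · exact hx h hh h₁

theorem cross_span_subset : X.Cross (X.span a U) ⊆ U := fun _ ⟨hh, ⟨_, hx, hxh⟩, _, hy, hyh⟩ =>
  sep_mem_of_span hx hy hh (fun e => hyh (e.1 hxh))

theorem span_eq_span (hb : b ∈ X.span a U) : X.span b U = X.span a U := by
  ext x
  constructor
  · intro hx h hh hs
    by_cases h₁ : a ∈ h ↔ b ∈ h
    · exact hx h hh (fun h₂ => hs (h₁.trans h₂))
    · exact hb h hh h₁
  · intro hx h hh hs
    exact sep_mem_of_span hb hx hh hs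

/-- A convex set is determined by one of its members and the halfspaces it crosses. -/
theorem IsConvexSet.eq_span (hX : X.IsCAT0) (hS : X.IsConvexSet S) (ha : a ∈ S) :
    S = X.span a (X.Cross S) := by
  ext x
  refine ⟨fun hx h hh hs => mem_cross_of_sep hh ha hx hs, fun hx => ?_⟩
  by_contra hxS
  have hne : x ≠ X.gate S x := fun h => hxS (h ▸ hS.gate_mem hX x)
  obtain ⟨h, hh, hxh, hg⟩ := exists_sep hX hne
  have ha' := hS.notMem_of_gate hX hh hxh hg ha
  have := hx h hh (fun e => ha' (e.2 hxh))
  exact hg ((hS.gate_mem_iff hX this x).2 hxh)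

/-- The image of a convex set under a gate map is convex. -/
theorem gate_image_isConvexSet (hX : X.IsCAT0) (hS : X.IsConvexSet S) (hT : X.IsConvexSet T) :
    X.IsConvexSet (X.gate S '' T) ∧ ∀ z ∈ X.gate S '' T, X.gate S (X.gate T z) = z := by
  suffices key : ∀ x ∈ T, ∀ y ∈ T, ∀ z, X.graph.dist (X.gate S x) z + X.graph.dist z (X.gate S y) =
      X.graph.dist (X.gate S x) (X.gate S y) → X.gate S (X.gate T z) = z by
    constructor
    · refine ⟨hT.nonempty.image _, ?_⟩
      rintro _ ⟨x, hx, rfl⟩ _ ⟨y, hy, rfl⟩ z hz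
      exact ⟨_, hT.gate_mem hX z, key x hx y hy z hz⟩
    · rintro _ ⟨x, hx, rfl⟩
      exact key x hx x hx _ (by simp)
  intro x hx y hy z hz
  have hzS : z ∈ S := hS.mem _ (hS.gate_mem hX x) _ (hS.gate_mem hX y) z hz
  by_contra hne
  obtain ⟨h, hh, hzh, hg⟩ := exists_sep hX (Ne.symm hne)
  have hhS : h ∈ X.Cross S := ⟨hh, ⟨z, hzS, hzh⟩, _, hS.gate_mem hX _, hg⟩
  rw [hS.gate_mem_iff hX hhS] at hg
  have hx' : X.gate S x ∉ h := by
    rw [hS.gate_mem_iff hX hhS]; exact hT.notMem_of_gate hX hh hzh hg hx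
  have hy' : X.gate S y ∉ h := by
    rw [hS.gate_mem_iff hX hhS]; exact hT.notMem_of_gate hX hh hzh hg hy
  exact ((hh.compl hX).isConvexSet hX).mem _ hx' _ hy' z hz hzh

theorem cross_gate_image (hX : X.IsCAT0) (hS : X.IsConvexSet S) :
    X.Cross (X.gate S '' T) = X.Cross S ∩ X.Cross T := by
  ext h
  constructor
  · rintro ⟨hh, ⟨_, ⟨x, hx, rfl⟩, hxh⟩, _, ⟨y, hy, rfl⟩, hyh⟩
    have hhS : h ∈ X.Cross S := ⟨hh, ⟨_, hS.gate_mem hX x, hxh⟩, _, hS.gate_mem hX y, hyh⟩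
    rw [hS.gate_mem_iff hX hhS] at hxh hyh
    exact ⟨hhS, hh, ⟨x, hx, hxh⟩, y, hy, hyh⟩
  · rintro ⟨hhS, hh, ⟨x, hx, hxh⟩, y, hy, hyh⟩
    exact ⟨hh, ⟨_, ⟨x, hx, rfl⟩, (hS.gate_mem_iff hX hhS x).2 hxh⟩, _, ⟨y, hy, rfl⟩,
      fun h => hyh ((hS.gate_mem_iff hX hhS y).1 h)⟩

/-- If `h` is transverse to all halfspaces crossed by `S`, then so are all halfspaces separating
a vertex of `S` from its gate in `h`. -/
theorem gate_mem_span_perp (hX : X.IsCAT0) (ha : a ∈ S) (hh : h ∈ X.perp (X.Cross S)) :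
    X.gate h a ∈ X.span a (X.perp (X.Cross S)) := by
  have hconv := hh.1.isConvexSet hX
  have key : ∀ k, X.IsHalf k → a ∈ k → X.gate h a ∉ k → k ∈ X.perp (X.Cross S) := by
    intro k hk hak hgk
    have hsub : ∀ z ∈ h, z ∉ k := fun z hz => hconv.notMem_of_gate hX hk hak hgk hz
    have hSk : ∀ z ∈ S, z ∈ k := by
      intro z hz
      by_contra hzk
      obtain ⟨w, hw, hwk⟩ := (hh.2 k ⟨hk, ⟨a, ha, hak⟩, z, hz, hzk⟩).pp
      exact hsub w hw hwk
    refine ⟨hk, fun l hl => ?_⟩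
    have ht := hh.2 l hl
    obtain ⟨hl, ⟨x, hx, hxl⟩, y, hy, hyl⟩ := hl
    exact ⟨⟨x, hSk x hx, hxl⟩, ⟨y, hSk y hy, hyl⟩,
      ht.pp.mono fun z hz => ⟨hsub z hz.1, hz.2⟩, ht.pn.mono fun z hz => ⟨hsub z hz.1, hz.2⟩⟩
  intro k hk hs
  by_cases hak : a ∈ k
  · exact key k hk hak (fun h => hs (iff_of_true hak h))
  · have := perp_compl hX (key kᶜ (hk.compl hX) hak (fun h => hs (iff_of_false hak h)))
    rwa [compl_compl] at this

/-- The halfspaces crossed by the orthogonal complement of `S` are those transverse to all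
halfspaces crossed by `S`. -/
theorem cross_span_perp (hX : X.IsCAT0) (ha : a ∈ S) :
    X.Cross (X.span a (X.perp (X.Cross S))) = X.perp (X.Cross S) := by
  refine cross_span_subset.antisymm fun h hh => ?_
  have h₁ := gate_mem_span_perp hX ha hh
  have h₂ := gate_mem_span_perp hX ha (perp_compl hX hh)
  exact ⟨hh.1, ⟨_, h₁, (hh.1.isConvexSet hX).gate_mem hX a⟩, _, h₂,
    ((hh.1.compl hX).isConvexSet hX).gate_mem hX a⟩

end Gates

/-! ### Cubes in terms of halfspaces -/

section Cubes

variable {n : ℕ} {φ : (Fin n → Bool) → V} {c h k S : Set V} {u v w w' : V}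

/-- The vertex of the standard cube obtained from `x` by changing the coordinates in `s`. -/
def flipOn {n : ℕ} (x : Fin n → Bool) (s : Finset (Fin n)) : Fin n → Bool :=
  fun i => if i ∈ s then !x i else x i

theorem flipOn_empty (x : Fin n → Bool) : flipOn x ∅ = x := by
  funext i; simp [flipOn]

theorem flipOn_insert (x : Fin n → Bool) {s : Finset (Fin n)} {j : Fin n} (hj : j ∉ s) :
    flipOn x (insert j s) = flipAt (flipOn x s) j := by
  funext i
  simp only [flipOn, flipAt_apply, Finset.mem_insert]
  by_cases h : i = j
  · subst h; simp [hj]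
  · simp [h]

theorem flipOn_filter (x y : Fin n → Bool) :
    flipOn x (Finset.univ.filter fun i => y i ≠ x i) = y := by
  funext i
  simp only [flipOn, Finset.mem_filter, Finset.mem_univ, true_and]
  cases h₁ : x i <;> cases h₂ : y i <;> simp

theorem chart_side_flipOn (hX : X.IsCAT0) (hφ : IsCubeChart X.cubes φ) (x : Fin n → Bool)
    (i : Fin n) (s : Finset (Fin n)) (hi : i ∉ s) :
    X.side (φ (flipOn x s)) (φ (flipAt (flipOn x s) i)) = X.side (φ x) (φ (flipAt x i)) := by
  induction s using Finset.induction_on with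
  | empty => rw [flipOn_empty]
  | @insert j s hj ih =>
    rw [Finset.mem_insert, not_or] at hi
    rw [← ih hi.2, flipOn_insert x hj, flipAt_comm _ j i,
      (chart_sq hφ (flipOn x s) hi.1).side_eq hX]

theorem chart_side_eq (hX : X.IsCAT0) (hφ : IsCubeChart X.cubes φ) {x y : Fin n → Bool}
    {i : Fin n} (h : y i = x i) :
    X.side (φ y) (φ (flipAt y i)) = X.side (φ x) (φ (flipAt x i)) := by
  have := chart_side_flipOn hX hφ x i (Finset.univ.filter fun i => y i ≠ x i) (by simp [h])
  rwa [flipOn_filter] at this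

/-- The halfspace bounded by an edge of a cube in direction `i` is given on the cube by the `i`-th
coordinate. -/
theorem chart_mem_side (hX : X.IsCAT0) (hφ : IsCubeChart X.cubes φ) {x y : Fin n → Bool}
    {i : Fin n} : φ y ∈ X.side (φ x) (φ (flipAt x i)) ↔ y i = x i := by
  constructor
  · intro h
    by_contra hne
    have h₁ : flipAt y i i = x i := by
      rw [flipAt_same]
      cases h₂ : y i <;> cases h₃ : x i <;> simp_all
    rw [← chart_side_eq hX hφ h₁, flipAt_flipAt] at h
    exact right_notMem_side h
  · intro h
    rw [← chart_side_eq hX hφ h]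
    exact left_mem_side ((chart_adj hφ).2 ⟨i, rfl⟩)

theorem chart_eq_side (hX : X.IsCAT0) (hφ : IsCubeChart X.cubes φ) {x y : Fin n → Bool}
    (hh : X.IsHalf h) (hx : φ x ∈ h) (hy : φ y ∉ h) :
    ∃ i, y i ≠ x i ∧ h = X.side (φ x) (φ (flipAt x i)) := by
  suffices key : ∀ s : Finset (Fin n), φ (flipOn x s) ∉ h →
      ∃ i ∈ s, h = X.side (φ x) (φ (flipAt x i)) by
    obtain ⟨i, hi, he⟩ := key (Finset.univ.filter fun i => y i ≠ x i) (by rwa [flipOn_filter])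
    exact ⟨i, by simpa using hi, he⟩
  intro s hs
  induction s using Finset.induction_on with
  | empty => rw [flipOn_empty] at hs; exact absurd hx hs
  | @insert j s hj ih =>
    by_cases h₁ : φ (flipOn x s) ∈ h
    · rw [flipOn_insert x hj] at hs
      refine ⟨j, Finset.mem_insert_self j s, ?_⟩
      rw [hh.eq_side hX ((chart_adj hφ).2 ⟨j, rfl⟩) h₁ hs]
      exact chart_side_flipOn hX hφ x j s hj
    · obtain ⟨i, hi, he⟩ := ih h₁
      exact ⟨i, Finset.mem_insert_of_mem hi, he⟩

/-- A convex set of vertices which crosses finitely many halfspaces, any two of which are equal,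
complementary or transverse. -/
structure IsCubical (X : CubeComplex V) (S : Set V) : Prop where
  convex : X.IsConvexSet S
  finite : (X.Cross S).Finite
  pairwise : ∀ h ∈ X.Cross S, ∀ k ∈ X.Cross S, h = k ∨ h = kᶜ ∨ Transverse h k

theorem isCubical_range (hX : X.IsCAT0) (hφ : IsCubeChart X.cubes φ) :
    X.IsCubical (Set.range φ) := by
  let x : Fin n → Bool := fun _ => false
  let H : Fin n → Set V := fun i => X.side (φ x) (φ (flipAt x i))
  have hadj : ∀ i, X.graph.Adj (φ x) (φ (flipAt x i)) := fun i => (chart_adj hφ).2 ⟨i, rfl⟩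
  have hmem : ∀ i y, φ y ∈ H i ↔ y i = x i := fun i y => chart_mem_side hX hφ
  have hsub : X.Cross (Set.range φ) ⊆ Set.range H ∪ Set.range fun i => (H i)ᶜ := by
    rintro h ⟨hh, ⟨_, ⟨y, rfl⟩, hy⟩, _, ⟨z, rfl⟩, hz⟩
    by_cases hx : φ x ∈ h
    · obtain ⟨i, -, hi⟩ := chart_eq_side hX hφ hh hx hz
      exact Or.inl ⟨i, hi.symm⟩
    · obtain ⟨i, -, hi⟩ := chart_eq_side hX hφ (hh.compl hX) (x := x) hx (fun h => h hy)
      exact Or.inr ⟨i, show (X.side _ _)ᶜ = h by rw [← hi, compl_compl]⟩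
  have hspan : Set.range φ = X.span (φ x) (Set.range H ∪ Set.range fun i => (H i)ᶜ) := by
    ext z
    constructor
    · rintro ⟨y, rfl⟩ h hh hs
      exact hsub (mem_cross_of_sep hh ⟨x, rfl⟩ ⟨y, rfl⟩ hs)
    · classical
      intro hz
      let y := flipOn x (Finset.univ.filter fun i => z ∉ H i)
      have hy : ∀ i, y i = x i ↔ z ∈ H i := fun i => by
        simp only [y, flipOn, Finset.mem_filter, Finset.mem_univ, true_and]
        by_cases h : z ∈ H i <;> simp [h]
      by_contra hne
      obtain ⟨h, hh, hzh, hyh⟩ := exists_sep hX (x := z) (y := φ y) (fun h => hne ⟨y, h.symm⟩)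
      by_cases hx : φ x ∈ h
      · obtain ⟨i, hi, rfl⟩ := chart_eq_side hX hφ hh hx hyh
        exact hi ((hy i).2 hzh)
      · rcases hz h hh (fun e => hx (e.2 hzh)) with ⟨i, rfl⟩ | ⟨i, rfl⟩
        · exact hx (left_mem_side (hadj i))
        · exact hyh fun h' => hzh ((hy i).1 ((hmem i y).1 h'))
  refine ⟨hspan ▸ span_isConvexSet hX, ((Set.finite_range _).union (Set.finite_range _)).subset
    hsub, ?_⟩
  have key : ∀ i j, H i = H j ∨ Transverse (H i) (H j) := fun i j => by
    by_cases hij : i = j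
    · exact Or.inl (by rw [hij])
    · refine Or.inr ⟨⟨φ x, ?_, ?_⟩, ⟨φ (flipAt x j), ?_, ?_⟩, ⟨φ (flipAt x i), ?_, ?_⟩,
        ⟨φ (flipAt (flipAt x i) j), ?_, ?_⟩⟩ <;>
      simp [hmem, flipAt_apply, hij, Ne.symm hij]
  intro h hh k hk
  rcases hsub hh with ⟨i, rfl⟩ | ⟨i, rfl⟩ <;> rcases hsub hk with ⟨j, rfl⟩ | ⟨j, rfl⟩ <;>
    rcases key i j with h | h
  · exact Or.inl h
  · exact Or.inr (Or.inr h)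
  · exact Or.inr (Or.inl (by rw [compl_compl]; exact h))
  · exact Or.inr (Or.inr h.compl_right)
  · exact Or.inr (Or.inl (congrArg compl h))
  · exact Or.inr (Or.inr h.compl_left)
  · exact Or.inl (congrArg compl h)
  · exact Or.inr (Or.inr h.compl_left.compl_right)

theorem IsCubical.exists_adj (hX : X.IsCAT0) (hS : X.IsCubical S) (hh : h ∈ X.Cross S)
    (hu : u ∈ S) (huh : u ∈ h) : ∃ w ∈ S, X.graph.Adj u w ∧ h = X.side u w := by
  have hT : X.IsConvexSet (S ∩ hᶜ) := hS.convex.inter ((hh.1.compl hX).isConvexSet hX) hh.2.2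
  have hw := hT.gate_mem hX u
  refine ⟨_, hw.1, (sep_eq_singleton_iff hX).1 (Set.eq_singleton_iff_unique_mem.2
    ⟨⟨hh.1, huh, hw.2⟩, fun k hk => ?_⟩)⟩
  have hkS : k ∈ X.Cross S := ⟨hk.1, ⟨u, hu, hk.2.1⟩, _, hw.1, hk.2.2⟩
  rcases hS.pairwise k hkS h hh with h₁ | rfl | ht
  · exact h₁
  · exact absurd huh hk.2.1
  · -- the halfspaces `k` and `hᶜ` and the set `S` meet pairwise, hence have a common point
    obtain ⟨p, hpk, hph⟩ := ht.pn
    refine absurd ((hS.convex.gate_mem_iff hX hkS p).2 hpk)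
      (hT.notMem_of_gate hX hk.1 hk.2.1 hk.2.2 ⟨hS.convex.gate_mem hX p, fun h' => hph ?_⟩)
    exact (hS.convex.gate_mem_iff hX hh p).1 h'

theorem eq_of_side_eq (hX : X.IsCAT0) (hw : X.graph.Adj v w) (hw' : X.graph.Adj v w')
    (h : X.side v w = X.side v w') : w = w' := by
  by_contra hne
  obtain ⟨k, hk, hwk, hwk'⟩ := exists_sep hX hne
  by_cases hv : v ∈ k
  · obtain rfl := hk.eq_side hX hw' hv hwk'
    rw [← h] at hwk
    exact right_notMem_side hwk
  · have := (hk.compl hX).eq_side hX hw hv (fun h => h hwk)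
    rw [h] at this
    have h₁ : w' ∈ kᶜ := hwk'
    exact right_notMem_side (this ▸ h₁)

/-- The neighbours of `v` in a cubical set pairwise span squares. -/
theorem IsCubical.exists_sq (hX : X.IsCAT0) (hS : X.IsCubical S) (hv : v ∈ S) (hw : w ∈ S)
    (hw' : w' ∈ S) (hvw : X.graph.Adj v w) (hvw' : X.graph.Adj v w') (hne : w ≠ w') :
    ∃ t, X.Sq v w t w' := by
  have e₁ := (sep_eq_singleton_iff hX).2 ⟨hvw, rfl⟩
  have e₂ := (sep_eq_singleton_iff hX).2 ⟨hvw', rfl⟩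
  have hside : X.side v w ≠ X.side v w' := fun h => hne (eq_of_side_eq hX hvw hvw' h)
  have hwk : w ∈ X.side v w' := by
    by_contra h
    have : X.side v w' ∈ X.Sep v w := ⟨⟨_, _, hvw', rfl⟩, left_mem_side hvw', h⟩
    rw [e₁] at this
    exact hside this.symm
  have hwk' : w' ∈ X.side v w := by
    by_contra h
    have : X.side v w ∈ X.Sep v w' := ⟨⟨_, _, hvw, rfl⟩, left_mem_side hvw, h⟩
    rw [e₂] at this
    exact hside this
  obtain ⟨t, -, hwt, ht⟩ := hS.exists_adj hX (h := X.side v w')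
    ⟨⟨_, _, hvw', rfl⟩, ⟨v, hv, left_mem_side hvw'⟩, w', hw', right_notMem_side⟩ hw hwk
  have e₃ := (sep_eq_singleton_iff hX).2 ⟨hwt, rfl⟩
  have htk : t ∉ X.side v w' := ht ▸ right_notMem_side
  have hth : t ∉ X.side v w := fun h => by
    have h₁ := (IsHalf.compl hX ⟨_, _, hvw, rfl⟩).eq_side hX hwt
      (right_notMem_side (X := X) (a := v)) (fun h' => h' h)
    rw [← ht] at h₁
    have h₂ : v ∈ (X.side v w)ᶜ := h₁ ▸ left_mem_side hvw'
    exact h₂ (left_mem_side hvw)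
  have hw't : X.graph.Adj w' t := by
    refine ((sep_eq_singleton_iff hX (h := X.side v w)).1 (Set.eq_singleton_iff_unique_mem.2
      ⟨⟨⟨_, _, hvw, rfl⟩, hwk', hth⟩, fun k hk => ?_⟩)).1
    by_cases hvk : v ∈ k
    · by_cases hwk₂ : w ∈ k
      · have : k ∈ X.Sep w t := ⟨hk.1, hwk₂, hk.2.2⟩
        rw [e₃, ← ht] at this
        obtain rfl := this
        exact absurd hk.2.1 right_notMem_side
      · have : k ∈ X.Sep v w := ⟨hk.1, hvk, hwk₂⟩
        rwa [e₁] at this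
    · have : kᶜ ∈ X.Sep v w' := ⟨hk.1.compl hX, hvk, fun h => h hk.2.1⟩
      rw [e₂] at this
      have h₁ : t ∈ kᶜ := hk.2.2
      exact absurd (this ▸ h₁) htk
  have htv : t ≠ v := by rintro rfl; exact hth (left_mem_side hvw)
  have d₀ := hX.1.1.pos_dist_of_ne htv
  have d₁ := SimpleGraph.dist_eq_one_iff_adj.2 hwt.symm
  have d₂ := SimpleGraph.dist_eq_one_iff_adj.2 hw't.symm
  have d₃ := hX.dist_adj t hvw
  obtain ⟨x, hx, -⟩ := hX.quadrangle t hvw hvw' hne (by omega) (by omega)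
  exact ⟨x, hx⟩

/-- The cubes are exactly the cubical sets. -/
theorem mem_cubes_iff (hX : X.IsCAT0) : c ∈ X.cubes ↔ X.IsCubical c := by
  constructor
  · intro hc
    obtain ⟨n, φ, hφ, rfl⟩ := X.exists_chart c hc
    exact isCubical_range hX hφ
  · intro hc
    obtain ⟨v, hv⟩ := hc.convex.nonempty
    have hfin : {w ∈ c | X.graph.Adj v w}.Finite := by
      refine Set.Finite.of_finite_image (f := fun w => X.side v w) (hc.finite.subset ?_) ?_
      · rintro _ ⟨w, ⟨hw, hvw⟩, rfl⟩
        exact ⟨⟨_, _, hvw, rfl⟩, ⟨v, hv, left_mem_side hvw⟩, w, hw, right_notMem_side⟩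
      · exact fun w hw w' hw' h => eq_of_side_eq hX hw.2 hw'.2 h
    obtain ⟨c', hc', hv', hs⟩ := exists_cube_of_flag (hX.2 v) hfin (fun w hw => hw.2)
      (fun w hw w' hw' hne => hc.exists_sq hX hv hw.1 hw'.1 hw.2 hw'.2 hne)
    have hc'' : X.IsCubical c' := by
      obtain ⟨n, φ, hφ, rfl⟩ := X.exists_chart c' hc'
      exact isCubical_range hX hφ
    have key : ∀ {d d' : Set V}, X.IsCubical d → v ∈ d → v ∈ d' →
        {w ∈ d | X.graph.Adj v w} = {w ∈ d' | X.graph.Adj v w} → X.Cross d ⊆ X.Cross d' := by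
      intro d d' hd hvd hvd' he
      have aux : ∀ h ∈ X.Cross d, v ∈ h → h ∈ X.Cross d' := by
        intro h hh hvh
        obtain ⟨w, hw, hvw, rfl⟩ := hd.exists_adj hX hh hvd hvh
        exact ⟨hh.1, ⟨v, hvd', hvh⟩, w, ((Set.ext_iff.1 he w).1 ⟨hw, hvw⟩).1, right_notMem_side⟩
      intro h hh
      by_cases hvh : v ∈ h
      · exact aux h hh hvh
      · have := cross_compl hX (aux hᶜ (cross_compl hX hh) hvh)
        rwa [compl_compl] at this
    rw [hc.convex.eq_span hX hv, (key hc hv hv' hs).antisymm (key hc'' hv' hv hs.symm),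
      ← hc''.convex.eq_span hX hv']
    exact hc'

end Cubes

/-! ### Convex subcomplexes -/

section Full

variable {S T h : Set V} {Y Y' : X.Subcomplex} {v y : V}

/-- The full subcomplex on a set of vertices. -/
def full (X : CubeComplex V) (S : Set V) : X.Subcomplex where
  cubes := {c ∈ X.cubes | c ⊆ S}
  subset _ h := h.1
  down_closed _ hc _ hd hdc := ⟨hd, hdc.trans hc.2⟩

theorem verts_full : (X.full S).verts = S := by
  ext v
  exact ⟨fun h => h.2 rfl, fun h => ⟨X.singleton_mem v, Set.singleton_subset_iff.2 h⟩⟩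

theorem Subcomplex.subset_verts {c : Set V} (hc : c ∈ Y.cubes) : c ⊆ Y.verts :=
  fun v hv => Y.down_closed c hc _ (X.singleton_mem v) (Set.singleton_subset_iff.2 hv)

theorem Subcomplex.IsConvex.eq_full (hY : Y.IsConvex) : Y = X.full Y.verts := by
  ext c
  exact ⟨fun hc => ⟨Y.subset hc, Y.subset_verts hc⟩, fun hc => hY.1 c hc.1 hc.2⟩

theorem Subcomplex.IsConvex.isConvexSet (hY : Y.IsConvex) (hne : Y.verts.Nonempty) :
    X.IsConvexSet Y.verts :=
  ⟨hne, hY.2⟩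

theorem IsConvexSet.isConvex_full (hS : X.IsConvexSet S) : (X.full S).IsConvex :=
  ⟨fun c hc hcS => ⟨hc, by rwa [verts_full] at hcS⟩, by rw [verts_full]; exact hS.mem⟩

theorem Subcomplex.IsConvex.ext (hY : Y.IsConvex) (hY' : Y'.IsConvex) (h : Y.verts = Y'.verts) :
    Y = Y' := by
  rw [hY.eq_full, hY'.eq_full, h]

theorem Subcomplex.isCompact_iff : Y.IsCompact ↔ Y.verts.Finite := by
  constructor
  · intro h
    exact Set.Finite.of_finite_image (f := fun v => ({v} : Set V))
      (h.subset (by rintro _ ⟨v, hv, rfl⟩; exact hv)) (Set.singleton_injective.injOn)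
  · intro h
    exact h.finite_subsets.subset fun c hc => Y.subset_verts hc

theorem isGate_iff (hX : X.IsCAT0) (hY : X.IsConvexSet Y.verts) :
    IsGate Y v y ↔ y = X.gate Y.verts v := by
  have hg := hY.gate_spec hX v
  constructor
  · rintro ⟨hy, hmin⟩
    by_contra hne
    have h₁ := hmin _ hg.1 (Ne.symm hne)
    have h₂ := hg.2 y hy
    omega
  · rintro rfl
    refine ⟨hg.1, fun z hz hne => ?_⟩
    have h₁ := hg.2 z hz
    have h₂ := hX.1.1.pos_dist_of_ne (Ne.symm hne)
    omega

theorem gate_image_mem_cubes (hX : X.IsCAT0) (hS : X.IsConvexSet S) {c : Set V}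
    (hc : c ∈ X.cubes) : X.gate S '' c ∈ X.cubes := by
  rw [mem_cubes_iff hX] at hc ⊢
  refine ⟨(gate_image_isConvexSet hX hS hc.convex).1, ?_, ?_⟩ <;> rw [cross_gate_image hX hS]
  · exact hc.finite.subset Set.inter_subset_right
  · exact fun h hh k hk => hc.pairwise h hh.2 k hk.2

/-- The image of a gate map is the full subcomplex on the gates of the vertices. -/
theorem gateImage_eq_full (hX : X.IsCAT0) (hY : X.IsConvexSet Y.verts) (hY' : Y'.IsConvex)
    (hne : Y'.verts.Nonempty) : gateImage Y Y' = X.full (X.gate Y.verts '' Y'.verts) := by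
  ext d
  constructor
  · rintro ⟨hd, c, hc, hdc⟩
    refine ⟨hd, fun y hy => ?_⟩
    obtain ⟨v, hv, hg⟩ := hdc hy
    exact ⟨v, Y'.subset_verts hc hv, ((isGate_iff hX hY).1 hg).symm⟩
  · rintro ⟨hd, hdS⟩
    have hYc' := hY'.isConvexSet hne
    refine ⟨hd, X.gate Y'.verts '' d, hY'.1 _ (gate_image_mem_cubes hX hYc' hd) ?_, ?_⟩
    · rintro _ ⟨z, -, rfl⟩
      exact hYc'.gate_mem hX z
    · intro z hz
      refine ⟨_, ⟨z, hz, rfl⟩, (isGate_iff hX hY).2 ?_⟩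
      exact ((gate_image_isConvexSet hX hY hYc').2 z (hdS hz)).symm

/-- A halfspace crossed by a convex set contains exactly one end of some edge of it. -/
theorem IsConvexSet.exists_edge (hX : X.IsCAT0) (hS : X.IsConvexSet S) (hh : h ∈ X.Cross S) :
    ∃ a ∈ S, ∃ b ∈ S, X.graph.Adj a b ∧ a ∈ h ∧ b ∉ h := by
  obtain ⟨hh, ⟨x, hx, hxh⟩, hy⟩ := hh
  have hT : X.IsConvexSet (S ∩ hᶜ) := hS.inter ((hh.compl hX).isConvexSet hX) hy
  have hw := hT.gate_mem hX x
  have hne : x ≠ X.gate (S ∩ hᶜ) x := fun e => hw.2 (e ▸ hxh)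
  have hpos := hX.1.1.pos_dist_of_ne hne
  obtain ⟨n, hn⟩ := Nat.exists_eq_add_one_of_ne_zero hpos.ne'
  obtain ⟨z, hz, hxz⟩ := exists_adj_dist hX hn
  have hzS : z ∈ S := hS.mem x hx _ hw.1 z (by
    rw [SimpleGraph.dist_eq_one_iff_adj.2 hz]; omega)
  refine ⟨z, hzS, _, hw.1, hz, ?_, hw.2⟩
  by_contra hzh
  have := (hT.gate_spec hX x).2 z ⟨hzS, hzh⟩
  omega

end Full

/-! ### Hyperplanes -/

section Hyperplanes

variable {n : ℕ} {φ : (Fin n → Bool) → V} {S T h c d : Set V} {Y Y' K : X.Subcomplex} {v y : V}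
  {E : Set (Sym2 V)}

/-- The edges with exactly one end in `h`. -/
def wall (X : CubeComplex V) (h : Set V) : Set (Sym2 V) :=
  {e | ∃ a b, X.graph.Adj a b ∧ a ∈ h ∧ b ∉ h ∧ e = s(a, b)}

theorem wall_compl : X.wall hᶜ = X.wall h := by
  ext e
  constructor
  · rintro ⟨a, b, hab, ha, hb, rfl⟩
    exact ⟨b, a, hab.symm, not_not.1 hb, ha, Sym2.eq_swap⟩
  · rintro ⟨a, b, hab, ha, hb, rfl⟩
    exact ⟨b, a, hab.symm, hb, fun h => h ha, Sym2.eq_swap⟩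

theorem edgesIn_wall_exists (hφ : IsCubeChart X.cubes φ)
    (hne : (edgesIn (X.wall h) (Set.range φ)).Nonempty) :
    ∃ x i, φ x ∈ h ∧ φ (flipAt x i) ∉ h := by
  obtain ⟨_, ⟨a, b, hab, ha, hb, rfl⟩, hc⟩ := hne
  obtain ⟨x, rfl⟩ := hc a (by simp)
  obtain ⟨y, rfl⟩ := hc b (by simp)
  obtain ⟨i, rfl⟩ := (chart_adj hφ).1 hab
  exact ⟨x, i, ha, hb⟩

theorem chart_mem_half (hX : X.IsCAT0) (hφ : IsCubeChart X.cubes φ) (hh : X.IsHalf h)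
    {x : Fin n → Bool} {i : Fin n} (hx : φ x ∈ h) (hx' : φ (flipAt x i) ∉ h) (y : Fin n → Bool) :
    φ y ∈ h ↔ y i = x i := by
  rw [hh.eq_side hX ((chart_adj hφ).2 ⟨i, rfl⟩) hx hx', chart_mem_side hX hφ]

theorem isMidcube_wall (hX : X.IsCAT0) (hφ : IsCubeChart X.cubes φ) (hh : X.IsHalf h)
    {x : Fin n → Bool} {i : Fin n} (hx : φ x ∈ h) (hx' : φ (flipAt x i) ∉ h) :
    IsMidcube φ i (edgesIn (X.wall h) (Set.range φ)) := by
  have hmem := chart_mem_half hX hφ hh hx hx'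
  ext e
  constructor
  · rintro ⟨⟨a, b, hab, ha, hb, rfl⟩, hc⟩
    obtain ⟨y, rfl⟩ := hc a (by simp)
    obtain ⟨z, rfl⟩ := hc b (by simp)
    obtain ⟨j, rfl⟩ := (chart_adj hφ).1 hab
    rw [hmem] at ha hb
    obtain rfl : i = j := by
      by_contra hij
      exact hb (by rw [flipAt_of_ne y hij, ha])
    exact ⟨y, rfl⟩
  · rintro ⟨y, rfl⟩
    refine ⟨?_, by
      intro v hv
      rcases Sym2.mem_iff.1 hv with rfl | rfl <;> exact ⟨_, rfl⟩⟩
    have hadj : X.graph.Adj (φ y) (φ (flipAt y i)) := (chart_adj hφ).2 ⟨i, rfl⟩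
    have hflip : φ (flipAt y i) ∈ h ↔ ¬ φ y ∈ h := by
      rw [hmem, hmem, flipAt_same]
      cases y i <;> cases x i <;> simp
    by_cases hy : φ y ∈ h
    · exact ⟨_, _, hadj, hy, fun h' => hflip.1 h' hy, rfl⟩
    · exact ⟨_, _, hadj.symm, hflip.2 hy, hy, Sym2.eq_swap⟩

theorem IsHalf.isHyperplane_wall (hX : X.IsCAT0) (hh : X.IsHalf h) : X.IsHyperplane (X.wall h) where
  nonempty := by
    obtain ⟨a, b, hab, rfl⟩ := hh
    exact ⟨_, a, b, hab, left_mem_side hab, right_notMem_side, rfl⟩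
  subset_edges := by
    rintro _ ⟨a, b, hab, -, -, rfl⟩
    exact hab
  midcube := by
    intro c hc
    rcases Set.eq_empty_or_nonempty (edgesIn (X.wall h) c) with he | hne
    · exact Or.inl he
    · obtain ⟨n, φ, hφ, rfl⟩ := X.exists_chart c hc
      obtain ⟨x, i, hx, hx'⟩ := edgesIn_wall_exists hφ hne
      exact Or.inr ⟨n, φ, i, hφ, rfl, isMidcube_wall hX hφ hh hx hx'⟩
  connected := by
    rintro _ ⟨a, b, hab, ha, hb, rfl⟩ _ ⟨x, y, hxy, hx, hy, rfl⟩
    have hs := hh.eq_side hX hxy hx hy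
    have hchain := exists_square_chain hX hxy hab (hs ▸ ha) (hs ▸ hb)
    have hside := hh.eq_side hX hab ha hb
    suffices key : ∀ p : V × V,
        Relation.ReflTransGen (fun p q : V × V => X.Sq p.1 p.2 q.2 q.1) (a, b) p →
        Relation.ReflTransGen (fun f f' => ∃ c ∈ X.cubes, f ∈ edgesIn (X.wall h) c ∧
          f' ∈ edgesIn (X.wall h) c) s(a, b) s(p.1, p.2) from key _ hchain
    intro p hp
    induction hp with
    | refl => exact .refl
    | @tail p q hp hs ih =>
      have hp' : h = X.side p.1 p.2 := hside.trans (side_eq_of_chain hX hp)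
      have hq' : h = X.side q.1 q.2 := hp'.trans (Sq.side_eq hX hs)
      refine ih.tail ⟨_, hs.mem, ⟨⟨p.1, p.2, hs.ab, ?_, ?_, rfl⟩, ?_⟩,
        ⟨q.1, q.2, hs.cd.symm, ?_, ?_, rfl⟩, ?_⟩
      · exact hp' ▸ left_mem_side hs.ab
      · exact hp' ▸ right_notMem_side
      · intro v hv; rcases Sym2.mem_iff.1 hv with rfl | rfl <;> simp
      · exact hq' ▸ left_mem_side hs.cd.symm
      · exact hq' ▸ right_notMem_side
      · intro v hv; rcases Sym2.mem_iff.1 hv with rfl | rfl <;> simp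

/-- Every hyperplane is the set of edges leaving some halfspace. -/
theorem IsHyperplane.exists_eq_wall (hX : X.IsCAT0) (hE : X.IsHyperplane E) :
    ∃ h, X.IsHalf h ∧ E = X.wall h := by
  obtain ⟨e, he⟩ := hE.nonempty
  have hadj := hE.subset_edges he
  induction e using Sym2.ind with
  | _ a b =>
  rw [SimpleGraph.mem_edgeSet] at hadj
  have hh : X.IsHalf (X.side a b) := ⟨a, b, hadj, rfl⟩
  have hab : s(a, b) ∈ X.wall (X.side a b) :=
    ⟨a, b, hadj, left_mem_side hadj, right_notMem_side, rfl⟩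
  -- in a cube containing an edge of both sets, both consist of the edges of the same midcube
  have key : ∀ c ∈ X.cubes, ∀ f ∈ edgesIn E c, f ∈ X.wall (X.side a b) →
      edgesIn E c = edgesIn (X.wall (X.side a b)) c := by
    intro c hc f hf hfw
    rcases hE.midcube c hc with h₀ | ⟨n, φ, i, hφ, rfl, hm⟩
    · rw [h₀] at hf; exact hf.elim
    · obtain ⟨x, rfl⟩ : ∃ x, f = s(φ x, φ (flipAt x i)) := by rw [hm] at hf; exact hf
      obtain ⟨a', b', -, ha', hb', he⟩ := hfw
      rcases Sym2.eq_iff.1 he with ⟨rfl, rfl⟩ | ⟨rfl, rfl⟩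
      · exact Eq.trans hm (isMidcube_wall hX hφ hh ha' hb').symm
      · refine Eq.trans hm (isMidcube_wall hX hφ hh (x := flipAt x i) ha' ?_).symm
        rwa [flipAt_flipAt]
  refine ⟨_, hh, Set.Subset.antisymm ?_ ?_⟩
  · intro f hf
    induction hE.connected _ he _ hf with
    | refl => exact hab
    | @tail g g' _ hg ih =>
      obtain ⟨c, hc, h₁, h₂⟩ := hg
      have := key c hc g h₁ (ih h₁.1)
      exact (this ▸ h₂ : g' ∈ edgesIn (X.wall (X.side a b)) c).1
  · intro f hf
    induction (hh.isHyperplane_wall hX).connected _ hab _ hf with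
    | refl => exact he
    | @tail g g' _ hg ih =>
      obtain ⟨c, hc, h₁, h₂⟩ := hg
      have := key c hc g ⟨ih h₁.1, h₁.2⟩ h₁.1
      exact (this ▸ h₂ : g' ∈ edgesIn E c).1

theorem crosses_wall_iff (hX : X.IsCAT0) (hY : Y.IsConvex) (hne : Y.verts.Nonempty)
    (hh : X.IsHalf h) : Crosses (X.wall h) Y ↔ h ∈ X.Cross Y.verts := by
  constructor
  · rintro ⟨c, hc, _, ⟨a, b, -, ha, hb, rfl⟩, he⟩
    exact ⟨hh, ⟨a, Y.subset_verts hc (he a (by simp)), ha⟩, b, Y.subset_verts hc (he b (by simp)),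
      hb⟩
  · intro hc
    obtain ⟨a, haS, b, hbS, hab, ha, hb⟩ := (hY.isConvexSet hne).exists_edge hX hc
    refine ⟨{a, b}, hY.1 _ hab.2 ?_, s(a, b), ⟨a, b, hab, ha, hb, rfl⟩, ?_⟩
    · rintro _ (rfl | rfl) <;> assumption
    · intro v hv; rcases Sym2.mem_iff.1 hv with rfl | rfl <;> simp

theorem parallel_iff (hX : X.IsCAT0) (hY : Y.IsConvex) (hne : Y.verts.Nonempty)
    (hY' : Y'.IsConvex) (hne' : Y'.verts.Nonempty) :
    Parallel Y Y' ↔ X.Cross Y.verts = X.Cross Y'.verts := by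
  constructor
  · intro hp
    ext h
    have key : X.IsHalf h → (h ∈ X.Cross Y.verts ↔ h ∈ X.Cross Y'.verts) := fun hh => by
      rw [← crosses_wall_iff hX hY hne hh, ← crosses_wall_iff hX hY' hne' hh]
      exact hp _ (hh.isHyperplane_wall hX)
    exact ⟨fun hc => (key hc.1).1 hc, fun hc => (key hc.1).2 hc⟩
  · intro he E hE
    obtain ⟨h, hh, rfl⟩ := hE.exists_eq_wall hX
    rw [crosses_wall_iff hX hY hne hh, crosses_wall_iff hX hY' hne' hh, he]

/-! ### Combinatorial hyperplanes -/

/-- The vertices of `h` which have a neighbour outside `h`. -/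
def frontier (X : CubeComplex V) (h : Set V) : Set V := {x ∈ h | ∃ y, X.graph.Adj x y ∧ y ∉ h}

theorem frontier_nonempty (hh : X.IsHalf h) : (X.frontier h).Nonempty := by
  obtain ⟨a, b, hab, rfl⟩ := hh
  exact ⟨a, left_mem_side hab, b, hab, right_notMem_side⟩

/-- The frontier of `h` is the orthogonal complement of an edge leaving `h`. -/
theorem frontier_eq_span (hX : X.IsCAT0) (hh : X.IsHalf h) {a : V} (ha : a ∈ X.frontier h) :
    X.frontier h = X.span a (X.perp {h}) := by
  obtain ⟨hah, b, hab, hb⟩ := ha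
  have hsab := (sep_eq_singleton_iff hX (h := h)).2 ⟨hab, hh.eq_side hX hab hah hb⟩
  ext x
  constructor
  · rintro ⟨hxh, y, hxy, hy⟩ k hk hs
    have hsxy := (sep_eq_singleton_iff hX (h := h)).2 ⟨hxy, hh.eq_side hX hxy hxh hy⟩
    have key : ∀ k, X.IsHalf k → a ∈ k → x ∉ k → Transverse k h := by
      intro k hk hak hxk
      refine ⟨⟨a, hak, hah⟩, ⟨b, ?_, hb⟩, ⟨x, hxk, hxh⟩, ⟨y, ?_, hy⟩⟩
      · by_contra hbk
        have : k ∈ X.Sep a b := ⟨hk, hak, hbk⟩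
        rw [hsab] at this
        exact hxk (this ▸ hxh)
      · intro hyk
        have : kᶜ ∈ X.Sep x y := ⟨hk.compl hX, hxk, fun h => h hyk⟩
        rw [hsxy] at this
        have h₁ : a ∈ kᶜ := this ▸ hah
        exact h₁ hak
    refine ⟨hk, ?_⟩
    rintro _ rfl
    by_cases hak : a ∈ k
    · exact key k hk hak fun h => hs (iff_of_true hak h)
    · have := (key kᶜ (hk.compl hX) hak fun h => hs (iff_of_false hak h)).compl_left
      rwa [compl_compl] at this
  · intro hx
    have hxh : x ∈ h := by
      by_contra hxh
      exact disjoint_perp (Set.mem_singleton h) (hx h hh fun e => hxh (e.1 hah))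
    have hconv := (hh.compl hX).isConvexSet hX
    refine ⟨hxh, X.gate hᶜ x, ((sep_eq_singleton_iff hX (h := h)).1
      (Set.eq_singleton_iff_unique_mem.2 ⟨⟨hh, hxh, hconv.gate_mem hX x⟩, fun k hk => ?_⟩)).1,
      hconv.gate_mem hX x⟩
    have hsub : ∀ z ∉ h, z ∉ k := fun z hz => hconv.notMem_of_gate hX hk.1 hk.2.1 hk.2.2 hz
    by_cases hak : a ∈ k
    · have : k ∈ X.Sep a b := ⟨hk.1, hak, hsub b hb⟩
      rwa [hsab] at this
    · obtain ⟨z, hzk, hz⟩ := ((hx k hk.1 fun e => hak (e.2 hk.2.1)).2 h rfl).pn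
      exact absurd hzk (hsub z hz)

theorem frontier_isConvexSet (hX : X.IsCAT0) (hh : X.IsHalf h) :
    X.IsConvexSet (X.frontier h) := by
  obtain ⟨a, ha⟩ := frontier_nonempty hh
  rw [frontier_eq_span hX hh ha]
  exact span_isConvexSet hX

theorem cross_frontier (hX : X.IsCAT0) (hh : X.IsHalf h) :
    X.Cross (X.frontier h) = X.perp {h} := by
  obtain ⟨a, ha⟩ := frontier_nonempty hh
  obtain ⟨hah, b, hab, hb⟩ := id ha
  have he : X.perp (X.Cross {a, b}) = X.perp {h} := by
    refine (perp_anti ?_).antisymm ?_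
    · rintro _ rfl
      exact ⟨hh, ⟨a, by simp, hah⟩, b, by simp, hb⟩
    · rintro k ⟨hk, ht⟩
      refine ⟨hk, ?_⟩
      have ht := ht h rfl
      rintro l ⟨hl, ⟨x, rfl | rfl, hx⟩, y, rfl | rfl, hy⟩
      · exact absurd hx hy
      · rw [hl.eq_side hX hab hx hy, ← hh.eq_side hX hab hah hb]; exact ht
      · rw [← compl_compl l, (hl.compl hX).eq_side hX hab hy (fun h => h hx),
          ← hh.eq_side hX hab hah hb]
        exact ht.compl_right
      · exact absurd hx hy
  rw [frontier_eq_span hX hh ha, ← he]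
  exact cross_span_perp hX (by simp)

theorem chart_comp_flip (hφ : IsCubeChart X.cubes φ) (i : Fin n) :
    IsCubeChart X.cubes (fun x => φ (flipAt x i)) := by
  have hinv : Function.Involutive (fun x : Fin n → Bool => flipAt x i) :=
    fun x => flipAt_flipAt x i
  have hface : ∀ t : Set (Fin n → Bool), IsCubeFace t → IsCubeFace ((flipAt · i) '' t) := by
    rintro _ ⟨I, ε, rfl⟩
    refine ⟨I, flipAt ε i, ?_⟩
    rw [hinv.image_eq_preimage_symm]
    ext x
    refine forall₂_congr fun j _ => ?_
    simp only [flipAt_apply]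
    split
    · cases x j <;> cases ε j <;> simp
    · rfl
  refine ⟨hφ.1.comp hinv.injective, fun s hs => ?_⟩
  rw [hφ.2 s (hs.trans (by rintro _ ⟨x, rfl⟩; exact ⟨_, rfl⟩))]
  constructor
  · rintro ⟨t, ht, rfl⟩
    refine ⟨_, hface t ht, ?_⟩
    rw [Set.image_image]
    simp only [flipAt_flipAt]
  · rintro ⟨t, ht, rfl⟩
    refine ⟨_, hface t ht, ?_⟩
    rw [Set.image_image]

/-- A cube crossed by the wall of `h` has a chart in which membership in `h` is given by a
coordinate. -/
theorem exists_chart_wall (hX : X.IsCAT0) (hh : X.IsHalf h) (hc : c ∈ X.cubes)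
    (hne : (edgesIn (X.wall h) c).Nonempty) :
    ∃ (n : ℕ) (φ : (Fin n → Bool) → V) (i : Fin n), IsCubeChart X.cubes φ ∧ Set.range φ = c ∧
      IsMidcube φ i (edgesIn (X.wall h) c) ∧ (∀ y, φ y ∈ h ↔ y i = true) ∧
      c ∩ X.frontier h = φ '' {x | x i = true} := by
  obtain ⟨n, φ, i, hφ, rfl, hm, hmem⟩ : ∃ (n : ℕ) (φ : (Fin n → Bool) → V) (i : Fin n),
      IsCubeChart X.cubes φ ∧ Set.range φ = c ∧ IsMidcube φ i (edgesIn (X.wall h) c) ∧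
      ∀ y, φ y ∈ h ↔ y i = true := by
    obtain ⟨n, φ, hφ, rfl⟩ := X.exists_chart c hc
    obtain ⟨x, i, hx, hx'⟩ := edgesIn_wall_exists hφ hne
    have hmem := chart_mem_half hX hφ hh hx hx'
    cases hxi : x i with
    | true =>
      exact ⟨n, φ, i, hφ, rfl, isMidcube_wall hX hφ hh hx hx', fun y => by rw [hmem, hxi]⟩
    | false =>
      have hr : Set.range (fun x => φ (flipAt x i)) = Set.range φ := by
        ext v
        constructor
        · rintro ⟨y, rfl⟩; exact ⟨_, rfl⟩
        · rintro ⟨y, rfl⟩; exact ⟨flipAt y i, by simp only [flipAt_flipAt]⟩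
      refine ⟨n, fun x => φ (flipAt x i), i, chart_comp_flip hφ i, hr, ?_, fun y => ?_⟩
      · rw [← hr]
        refine isMidcube_wall hX (chart_comp_flip hφ i) hh (x := flipAt x i) ?_ ?_
        · simpa only [flipAt_flipAt] using hx
        · simpa only [flipAt_flipAt] using hx'
      · rw [hmem, flipAt_same, hxi]; simp
  refine ⟨n, φ, i, hφ, rfl, hm, hmem, ?_⟩
  ext v
  constructor
  · rintro ⟨⟨y, rfl⟩, hy, -⟩
    exact ⟨y, (hmem y).1 hy, rfl⟩
  · rintro ⟨y, hy, rfl⟩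
    refine ⟨⟨y, rfl⟩, (hmem y).2 hy, φ (flipAt y i), (chart_adj hφ).2 ⟨i, rfl⟩, ?_⟩
    rw [hmem, flipAt_same, show y i = true from hy]
    simp

/-- The cubes in the frontier of `h` are the faces, on the side of `h`, of the cubes crossed by the
wall of `h`. -/
theorem cubes_full_frontier (hX : X.IsCAT0) (hh : X.IsHalf h) :
    (X.full (X.frontier h)).cubes =
      {d | ∃ c ∈ X.cubes, (edgesIn (X.wall h) c).Nonempty ∧ d = c ∩ X.frontier h} := by
  ext d
  constructor
  · rintro ⟨hd, hdS⟩
    rw [mem_cubes_iff hX] at hd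
    obtain ⟨v, hv⟩ := hd.convex.nonempty
    obtain ⟨hvh, w, hvw, hw⟩ := hdS hv
    have hs := (sep_eq_singleton_iff hX (h := h)).2 ⟨hvw, hh.eq_side hX hvw hvh hw⟩
    have hperp : ∀ k ∈ X.Cross d, Transverse k h := fun k hk =>
      ((cross_frontier hX hh ▸ cross_mono hdS hk : k ∈ X.perp {h})).2 h rfl
    -- the cube spanned by `d` and its translate across the wall of `h`
    let c := X.span v (X.Cross d ∪ {h, hᶜ})
    have hwc : w ∈ c := by
      intro k hk hsep
      right
      by_cases hvk : v ∈ k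
      · have : k ∈ X.Sep v w := ⟨hk, hvk, fun h => hsep (iff_of_true hvk h)⟩
        rw [hs] at this
        exact Or.inl this
      · have : kᶜ ∈ X.Sep v w :=
          ⟨hk.compl hX, hvk, fun h => h (by by_contra h'; exact hsep (iff_of_false hvk h'))⟩
        rw [hs] at this
        exact Or.inr (by rw [Set.mem_singleton_iff, ← (this : kᶜ = h), compl_compl])
    have hc : X.IsCubical c := by
      refine ⟨span_isConvexSet hX, (hd.finite.union (by simp)).subset cross_span_subset, ?_⟩
      intro k hk l hl
      rcases cross_span_subset hk with hk' | rfl | rfl <;>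
        rcases cross_span_subset hl with hl' | rfl | rfl
      · exact hd.pairwise k hk' l hl'
      · exact Or.inr (Or.inr (hperp k hk'))
      · exact Or.inr (Or.inr (hperp k hk').compl_right)
      · exact Or.inr (Or.inr (hperp l hl').symm)
      · exact Or.inl rfl
      · exact Or.inr (Or.inl (compl_compl _).symm)
      · exact Or.inr (Or.inr (hperp l hl').symm.compl_left)
      · exact Or.inr (Or.inl rfl)
      · exact Or.inl rfl
    refine ⟨c, (mem_cubes_iff hX).2 hc, ⟨s(v, w), ⟨v, w, hvw, hvh, hw, rfl⟩, ?_⟩, ?_⟩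
    · intro x hx
      rcases Sym2.mem_iff.1 hx with rfl | rfl
      exacts [self_mem_span, hwc]
    · ext x
      constructor
      · intro hx
        exact ⟨fun k hk hs => Or.inl (mem_cross_of_sep hk hv hx hs), hdS hx⟩
      · rintro ⟨hx, hxh, -⟩
        rw [hd.convex.eq_span hX hv]
        intro k hk hsep
        rcases hx k hk hsep with hk' | rfl | rfl
        · exact hk'
        · exact absurd (iff_of_true hvh hxh) hsep
        · exact absurd (iff_of_false (fun h => h hvh) fun h => h hxh) hsep
  · rintro ⟨c, hc, hne, rfl⟩
    obtain ⟨n, φ, i, hφ, rfl, -, -, he⟩ := exists_chart_wall hX hh hc hne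
    refine ⟨?_, Set.inter_subset_right⟩
    rw [he]
    refine (hφ.2 _ (Set.image_subset_range _ _)).2 ⟨_, ⟨{i}, fun _ => true, rfl⟩, ?_⟩
    congr 1
    ext x
    simp

theorem isCombHyperplane_frontier (hX : X.IsCAT0) (hh : X.IsHalf h) :
    IsCombHyperplane (X.full (X.frontier h)) := by
  refine ⟨X.wall h, hh.isHyperplane_wall hX, ?_, ?_⟩
  · intro c hc hne
    obtain ⟨n, φ, i, hφ, hr, hm, -, he⟩ := exists_chart_wall hX hh hc hne
    exact ⟨n, φ, i, hφ, hr, hm, by rw [verts_full, he]⟩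
  · rw [verts_full]; exact cubes_full_frontier hX hh

/-- If `K` contains the inner but not the outer end of every edge leaving `h`, then the side `K`
of the carrier is the frontier of `h`. -/
theorem IsCombHyperplaneOf.eq_full (hX : X.IsCAT0) (hh : X.IsHalf h)
    (hK : IsCombHyperplaneOf (X.wall h) K)
    (hside : ∀ a b, X.graph.Adj a b → a ∈ h → b ∉ h → a ∈ K.verts ∧ b ∉ K.verts) :
    K = X.full (X.frontier h) := by
  have hverts : K.verts = X.frontier h := by
    ext v
    constructor
    · intro hv
      have hv' : {v} ∈ K.cubes := hv
      rw [hK.2] at hv'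
      obtain ⟨c, hc, hne, he⟩ := hv'
      obtain ⟨n, φ, i, hφ, rfl, hm, hK'⟩ := hK.1 c hc hne
      rw [hK'] at he
      obtain ⟨x, -, rfl⟩ := (he ▸ rfl : v ∈ φ '' {x | x i = true})
      have : s(φ x, φ (flipAt x i)) ∈ edgesIn (X.wall h) (Set.range φ) := by
        rw [hm]; exact ⟨x, rfl⟩
      obtain ⟨⟨a, b, hab, ha, hb, he⟩, -⟩ := this
      rcases Sym2.eq_iff.1 he with ⟨rfl, rfl⟩ | ⟨rfl, rfl⟩
      · exact ⟨ha, _, hab, hb⟩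
      · exact absurd hv (hside _ _ hab ha hb).2
    · rintro ⟨hvh, w, hvw, hw⟩
      exact (hside v w hvw hvh hw).1
  ext d
  rw [hK.2, cubes_full_frontier hX hh, hverts]

/-- For two edges of one cube leaving `h`, the side `K` of the carrier contains either both inner ends
or both outer ends, and never both ends of one edge. -/
theorem IsCombHyperplaneOf.same_side (hX : X.IsCAT0) (hh : X.IsHalf h)
    (hK : IsCombHyperplaneOf (X.wall h) K) (hc : c ∈ X.cubes)
    {a b a' b' : V} (ha : a ∈ h) (hb : b ∉ h) (ha' : a' ∈ h) (hb' : b' ∉ h)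
    (hab : s(a, b) ∈ edgesIn (X.wall h) c) (hab' : s(a', b') ∈ edgesIn (X.wall h) c) :
    ((a ∈ K.verts ∧ b ∉ K.verts) ∨ (a ∉ K.verts ∧ b ∈ K.verts)) ∧
      (a ∈ K.verts ↔ a' ∈ K.verts) := by
  obtain ⟨n, φ, i, hφ, rfl, hm, hK'⟩ := hK.1 c hc ⟨_, hab⟩
  have hmemK : ∀ x, φ x ∈ K.verts ↔ x i = true := fun x => by
    constructor
    · intro h
      obtain ⟨y, hy, he⟩ : φ x ∈ φ '' {x | x i = true} := hK' ▸ ⟨⟨x, rfl⟩, h⟩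
      exact hφ.1 he ▸ hy
    · intro h
      exact (hK' ▸ ⟨x, h, rfl⟩ : φ x ∈ Set.range φ ∩ K.verts).2
  have key : ∀ a b, a ∈ h → b ∉ h → s(a, b) ∈ edgesIn (X.wall h) (Set.range φ) →
      ∃ x, a = φ x ∧ b = φ (flipAt x i) := by
    intro a b ha hb hab
    rw [hm] at hab
    obtain ⟨x, he⟩ := hab
    rcases Sym2.eq_iff.1 he with ⟨rfl, rfl⟩ | ⟨rfl, rfl⟩
    · exact ⟨x, rfl, rfl⟩
    · exact ⟨flipAt x i, rfl, by rw [flipAt_flipAt]⟩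
  obtain ⟨x, rfl, rfl⟩ := key a b ha hb hab
  obtain ⟨y, rfl, rfl⟩ := key a' b' ha' hb' hab'
  have hy := (chart_mem_half hX hφ hh ha hb y).1 ha'
  simp only [hmemK, flipAt_same, hy]
  cases x i <;> simp

theorem IsCombHyperplane.exists_eq_frontier (hX : X.IsCAT0) (hK : IsCombHyperplane K) :
    ∃ h, X.IsHalf h ∧ K = X.full (X.frontier h) := by
  obtain ⟨E, hE, hK⟩ := hK
  obtain ⟨h, hh, rfl⟩ := hE.exists_eq_wall hX
  obtain ⟨a, b, hab, rfl⟩ := id hh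
  set h := X.side a b
  have ha : a ∈ h := left_mem_side hab
  have hb : b ∉ h := right_notMem_side
  -- the side on which `K` lies does not change along the wall
  have key : ∀ e ∈ X.wall h, ∀ x y, e = s(x, y) → x ∈ h → y ∉ h →
      ((x ∈ K.verts ∧ y ∉ K.verts) ∨ (x ∉ K.verts ∧ y ∈ K.verts)) ∧
        (a ∈ K.verts ↔ x ∈ K.verts) := by
    intro e he
    have hmem : s(a, b) ∈ edgesIn (X.wall h) {a, b} := ⟨⟨a, b, hab, ha, hb, rfl⟩, fun v hv => by
      rcases Sym2.mem_iff.1 hv with rfl | rfl <;> simp⟩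
    induction (hh.isHyperplane_wall hX).connected _ ⟨a, b, hab, ha, hb, rfl⟩ _ he with
    | refl =>
      intro x y hxy hx hy
      rcases Sym2.eq_iff.1 hxy with ⟨rfl, rfl⟩ | ⟨rfl, rfl⟩
      · exact ⟨(hK.same_side hX hh hab.2 ha hb ha hb hmem hmem).1, Iff.rfl⟩
      · exact absurd ha hy
    | @tail f g _ hfg ih =>
      obtain ⟨c, hc, hf, hg⟩ := hfg
      rintro x y rfl hx hy
      obtain ⟨x', y', -, hx', hy', rfl⟩ := id hf.1
      have h₁ := hK.same_side hX hh hc hx hy hx' hy' hg hf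
      exact ⟨h₁.1, ((ih hf.1) x' y' rfl hx' hy').2.trans h₁.2.symm⟩
  by_cases haK : a ∈ K.verts
  · refine ⟨h, hh, hK.eq_full hX hh fun x y hxy hx hy => ?_⟩
    have := key _ ⟨x, y, hxy, hx, hy, rfl⟩ x y rfl hx hy
    tauto
  · refine ⟨hᶜ, hh.compl hX, IsCombHyperplaneOf.eq_full hX (hh.compl hX) (by rwa [wall_compl])
      fun x y hxy hx hy => ?_⟩
    have := key _ ⟨y, x, hxy.symm, not_not.1 hy, hx, rfl⟩ y x rfl (not_not.1 hy) hx
    tauto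

end Hyperplanes

/-! ### Orthogonal complements -/

section Orthogonal

variable {S c c' d : Set V} {a x x' y y' z : V} {h : Set V} {A O : X.Subcomplex}

/-- The vertices of the orthogonal complement of `S` at `a`: those which are separated from `a`
only by halfspaces transverse to all halfspaces crossed by `S`. -/
def orth (X : CubeComplex V) (S : Set V) (a : V) : Set V := X.span a (X.perp (X.Cross S))

/-- The vertices of the parallel copies of the convex set `S`, where `a ∈ S`. It is encoded as the
set of vertices separated from `a` only by halfspaces which are crossed by `S` or transverse to
all halfspaces crossed by `S`. -/
def copies (X : CubeComplex V) (S : Set V) (a : V) : Set V :=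
  X.span a (X.Cross S ∪ X.perp (X.Cross S))

/-- The product map: `(x, y)` goes to the gate of `y` in the orthogonal complement at `x`. -/
noncomputable def orthMap (X : CubeComplex V) (S : Set V) (p : V × V) : V :=
  X.gate (X.orth S p.1) p.2

theorem orth_isConvexSet (hX : X.IsCAT0) : X.IsConvexSet (X.orth S a) := span_isConvexSet hX

theorem cross_orth (hX : X.IsCAT0) (ha : a ∈ S) : X.Cross (X.orth S a) = X.perp (X.Cross S) :=
  cross_span_perp hX ha

/-- A halfspace crossed by `S` does not see the second coordinate of a point. -/
theorem orthMap_mem_iff_left (hX : X.IsCAT0) (hh : h ∈ X.Cross S) :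
    X.orthMap S (x, y) ∈ h ↔ x ∈ h := by
  by_contra hs
  exact disjoint_perp hh ((orth_isConvexSet hX).gate_mem hX y h hh.1 fun e => hs e.symm)

/-- A halfspace transverse to those crossed by `S` does not see the first coordinate. -/
theorem orthMap_mem_iff_right (hX : X.IsCAT0) (hx : x ∈ S) (hh : h ∈ X.perp (X.Cross S)) :
    X.orthMap S (x, y) ∈ h ↔ y ∈ h := by
  refine (orth_isConvexSet hX).gate_mem_iff hX ?_ y
  rwa [cross_orth hX hx]

theorem orthMap_mem_copies (hX : X.IsCAT0) (ha : a ∈ S) (hx : x ∈ S) :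
    X.orthMap S (x, y) ∈ X.copies S a := by
  intro h hh hs
  by_cases h₁ : a ∈ h ↔ x ∈ h
  · exact Or.inr ((orth_isConvexSet hX).gate_mem hX y h hh fun h₂ => hs (h₁.trans h₂))
  · exact Or.inl (mem_cross_of_sep hh ha hx h₁)

theorem eq_orthMap (hX : X.IsCAT0) (ha : a ∈ S) (hx : x ∈ S) (hz : z ∈ X.copies S a)
    (h₁ : ∀ h ∈ X.Cross S, z ∈ h ↔ x ∈ h) (h₂ : ∀ h ∈ X.perp (X.Cross S), z ∈ h ↔ y ∈ h) :
    z = X.orthMap S (x, y) := by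
  by_contra hne
  obtain ⟨h, hh, hzh, hyh⟩ := exists_sep hX hne
  rcases sep_mem_of_span hz (orthMap_mem_copies hX ha hx (y := y)) hh (fun e => hyh (e.1 hzh)) with
    hc | hc
  · exact hyh ((orthMap_mem_iff_left hX hc).2 ((h₁ h hc).1 hzh))
  · exact hyh ((orthMap_mem_iff_right hX hx hc).2 ((h₂ h hc).1 hzh))

theorem orthMap_left (hX : X.IsCAT0) (ha : a ∈ S) (hx : x ∈ S) : X.orthMap S (x, a) = x := by
  refine (eq_orthMap hX ha hx (fun h hh hs => Or.inl (mem_cross_of_sep hh ha hx hs))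
    (fun _ _ => Iff.rfl) fun h hh => ?_).symm
  by_contra hs
  exact disjoint_perp (mem_cross_of_sep hh.1 hx ha hs) hh

theorem orthMap_right (hX : X.IsCAT0) (ha : a ∈ S) (hy : y ∈ X.orth S a) :
    X.orthMap S (a, y) = y := by
  refine (eq_orthMap hX ha ha (span_mono Set.subset_union_right hy)
    (fun h hh => ?_) fun _ _ => Iff.rfl).symm
  by_contra hs
  exact disjoint_perp hh (hy h hh.1 fun e => hs e.symm)

/-- The coordinates of a point in a parallel copy are its gates. -/
theorem orthMap_gates (hX : X.IsCAT0) (hS : X.IsConvexSet S) (ha : a ∈ S)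
    (hz : z ∈ X.copies S a) : X.orthMap S (X.gate S z, X.gate (X.orth S a) z) = z := by
  refine (eq_orthMap hX ha (hS.gate_mem hX z) hz (fun h hh => (hS.gate_mem_iff hX hh z).symm)
    fun h hh => ((orth_isConvexSet hX).gate_mem_iff hX ?_ z).symm).symm
  rwa [cross_orth hX ha]

theorem dist_orthMap (hX : X.IsCAT0) (ha : a ∈ S) (hx : x ∈ S) (hy : y ∈ X.orth S a)
    (hx' : x' ∈ S) (hy' : y' ∈ X.orth S a) :
    X.graph.dist (X.orthMap S (x, y)) (X.orthMap S (x', y')) =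
      X.graph.dist x x' + X.graph.dist y y' := by
  have h₁ : ∀ h ∈ X.Sep x x', h ∈ X.Cross S := fun h hh =>
    ⟨hh.1, ⟨x, hx, hh.2.1⟩, x', hx', hh.2.2⟩
  have h₂ : ∀ h ∈ X.Sep y y', h ∈ X.perp (X.Cross S) := fun h hh =>
    sep_mem_of_span hy hy' hh.1 fun e => hh.2.2 (e.1 hh.2.1)
  have he : X.Sep (X.orthMap S (x, y)) (X.orthMap S (x', y')) = X.Sep x x' ∪ X.Sep y y' := by
    ext h
    constructor
    · rintro ⟨hh, hm, hm'⟩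
      rcases sep_mem_of_span (orthMap_mem_copies hX ha hx) (orthMap_mem_copies hX ha hx') hh
        (fun e => hm' (e.1 hm)) with hc | hc
      · rw [orthMap_mem_iff_left hX hc] at hm hm'
        exact Or.inl ⟨hh, hm, hm'⟩
      · rw [orthMap_mem_iff_right hX hx hc] at hm
        rw [orthMap_mem_iff_right hX hx' hc] at hm'
        exact Or.inr ⟨hh, hm, hm'⟩
    · rintro (hh | hh)
      · refine ⟨hh.1, ?_, ?_⟩ <;> rw [orthMap_mem_iff_left hX (h₁ h hh)]
        exacts [hh.2.1, hh.2.2]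
      · refine ⟨hh.1, ?_, ?_⟩
        · rw [orthMap_mem_iff_right hX hx (h₂ h hh)]; exact hh.2.1
        · rw [orthMap_mem_iff_right hX hx' (h₂ h hh)]; exact hh.2.2
  have hd : Disjoint (X.Sep x x') (X.Sep y y') :=
    Set.disjoint_left.2 fun h hh hh' => disjoint_perp (h₁ h hh) (h₂ h hh')
  rw [← ncard_sep hX, he, Set.ncard_union_eq hd (sep_finite hX _ _) (sep_finite hX _ _),
    ncard_sep hX, ncard_sep hX]

/-- The copy of `S` through a vertex `z` of `copies` consists of the vertices separated from `z` only
by halfspaces crossed by `S`. -/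
theorem cross_span_of_mem_copies (hX : X.IsCAT0) (ha : a ∈ S)
    (hz : z ∈ X.copies S a) : X.Cross (X.span z (X.Cross S)) = X.Cross S := by
  refine cross_span_subset.antisymm fun h hh => ?_
  have key : ∀ x ∈ S, X.orthMap S (x, X.gate (X.orth S a) z) ∈ X.span z (X.Cross S) := by
    intro x hx k hk hs
    rcases sep_mem_of_span hz (orthMap_mem_copies hX ha hx) hk hs with hc | hc
    · exact hc
    · exfalso
      rw [orthMap_mem_iff_right hX hx hc,
        (orth_isConvexSet hX).gate_mem_iff hX (by rwa [cross_orth hX ha])] at hs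
      exact hs Iff.rfl
  obtain ⟨hh', ⟨x, hx, hxh⟩, y, hy, hyh⟩ := id hh
  exact ⟨hh', ⟨_, key x hx, (orthMap_mem_iff_left hX hh).2 hxh⟩, _, key y hy,
    fun h' => hyh ((orthMap_mem_iff_left hX hh).1 h')⟩

/-- A convex set crossing the same halfspaces as `S` consists of vertices of copies of `S`: a
halfspace separating it from `S` is transverse to all halfspaces crossed by `S`. -/
theorem subset_copies (hX : X.IsCAT0) {T : Set V} (ha : a ∈ S) (he : X.Cross T = X.Cross S) :
    T ⊆ X.copies S a := by
  have key : ∀ h, X.IsHalf h → a ∈ h → ∀ z ∈ T, z ∉ h →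
      h ∈ X.Cross S ∪ X.perp (X.Cross S) := by
    intro h hh hah z hz hzh
    by_cases hc : h ∈ X.Cross S
    · exact Or.inl hc
    · refine Or.inr ⟨hh, fun k hk => ?_⟩
      have hS : ∀ x ∈ S, x ∈ h := fun x hx => by
        by_contra hxh
        exact hc ⟨hh, ⟨a, ha, hah⟩, x, hx, hxh⟩
      have hT : ∀ x ∈ T, x ∉ h := fun x hx hxh => hc (he ▸ ⟨hh, ⟨x, hx, hxh⟩, z, hz, hzh⟩)
      have hk' : k ∈ X.Cross T := he ▸ hk
      obtain ⟨-, ⟨x, hx, hxk⟩, y, hy, hyk⟩ := hk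
      obtain ⟨-, ⟨x', hx', hxk'⟩, y', hy', hyk'⟩ := hk'
      exact ⟨⟨x, hS x hx, hxk⟩, ⟨y, hS y hy, hyk⟩, ⟨x', hT x' hx', hxk'⟩, ⟨y', hT y' hy', hyk'⟩⟩
  intro z hz h hh hs
  by_cases hah : a ∈ h
  · exact key h hh hah z hz fun h' => hs (iff_of_true hah h')
  · rcases key hᶜ (hh.compl hX) hah z hz
      (fun h' => hs (iff_of_false hah h')) with hc | hc
    · have := cross_compl hX hc
      rw [compl_compl] at this
      exact Or.inl this
    · have := perp_compl hX hc
      rw [compl_compl] at this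
      exact Or.inr this

theorem parallelHull_eq_full (hX : X.IsCAT0) (hA : A.IsConvex) (ha : a ∈ A.verts) :
    parallelHull A = X.full (X.copies A.verts a) := by
  ext c
  constructor
  · rintro ⟨hc, hY⟩
    refine hY _ (IsConvexSet.isConvex_full (span_isConvexSet hX)) ?_
    rintro d ⟨A', hA', hne, hp, hd⟩
    rw [parallel_iff hX hA' hne hA ⟨a, ha⟩] at hp
    exact ⟨A'.subset hd, (A'.subset_verts hd).trans (subset_copies hX ha hp)⟩
  · rintro ⟨hc, hcP⟩
    refine ⟨hc, fun Y hY hsub => hY.1 c hc fun z hz => hsub ?_⟩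
    have hconv : X.IsConvexSet (X.span z (X.Cross A.verts)) := span_isConvexSet hX
    refine ⟨_, hconv.isConvex_full, by rw [verts_full]; exact hconv.nonempty, ?_,
      X.singleton_mem z, Set.singleton_subset_iff.2 self_mem_span⟩
    rw [parallel_iff hX hconv.isConvex_full (by rw [verts_full]; exact hconv.nonempty) hA ⟨a, ha⟩,
      verts_full, cross_span_of_mem_copies hX ha (hcP hz)]

/-- The product of a cube of `S` and a cube of the orthogonal complement is a cube. -/
theorem image_orthMap_mem_cubes (hX : X.IsCAT0) (hS : X.IsConvexSet S) (ha : a ∈ S)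
    (hc : c ∈ X.cubes) (hcS : c ⊆ S) (hc' : c' ∈ X.cubes) (hcO : c' ⊆ X.orth S a) :
    X.orthMap S '' (c ×ˢ c') ∈ X.cubes := by
  rw [mem_cubes_iff hX] at hc hc' ⊢
  obtain ⟨x, hx⟩ := hc.convex.nonempty
  obtain ⟨y, hy⟩ := hc'.convex.nonempty
  have hU : X.Cross c ⊆ X.Cross S := cross_mono hcS
  have hU' : X.Cross c' ⊆ X.perp (X.Cross S) := cross_orth hX ha ▸ cross_mono hcO
  have hp := orthMap_mem_copies hX ha (hcS hx) (y := y)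
  have he : X.orthMap S '' (c ×ˢ c') =
      X.span (X.orthMap S (x, y)) (X.Cross c ∪ X.Cross c') := by
    ext z
    constructor
    · rintro ⟨⟨x', y'⟩, ⟨hx', hy'⟩, rfl⟩ h hh hs
      simp only at hx' hy'
      rcases sep_mem_of_span hp (orthMap_mem_copies hX ha (hcS hx')) hh hs with hk | hk
      · rw [orthMap_mem_iff_left hX hk, orthMap_mem_iff_left hX hk] at hs
        exact Or.inl (mem_cross_of_sep hh hx hx' hs)
      · rw [orthMap_mem_iff_right hX (hcS hx) hk, orthMap_mem_iff_right hX (hcS hx') hk] at hs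
        exact Or.inr (mem_cross_of_sep hh hy hy' hs)
    · intro hz
      have hzP : z ∈ X.copies S a := by
        have := span_mono (Set.union_subset_union hU hU') hz
        rwa [span_eq_span hp] at this
      refine ⟨(X.gate S z, X.gate (X.orth S a) z), ⟨?_, ?_⟩, orthMap_gates hX hS ha hzP⟩
      · change X.gate S z ∈ c
        rw [hc.convex.eq_span hX hx]
        intro h hh hs
        have hk := mem_cross_of_sep hh (hcS hx) (hS.gate_mem hX z) hs
        rw [hS.gate_mem_iff hX hk, ← orthMap_mem_iff_left hX hk (y := y)] at hs
        exact (hz h hh hs).resolve_right fun h' => disjoint_perp hk (hU' h')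
      · change X.gate (X.orth S a) z ∈ c'
        rw [hc'.convex.eq_span hX hy]
        intro h hh hs
        have hk := mem_cross_of_sep hh (hcO hy) ((orth_isConvexSet hX).gate_mem hX z) hs
        have hk' := hk
        rw [cross_orth hX ha] at hk'
        rw [(orth_isConvexSet hX).gate_mem_iff hX hk,
          ← orthMap_mem_iff_right hX (hcS hx) hk'] at hs
        exact (hz h hh hs).resolve_left fun h' => disjoint_perp (hU h') hk'
  rw [he]
  refine ⟨span_isConvexSet hX, (hc.finite.union hc'.finite).subset cross_span_subset, ?_⟩
  intro h hh k hk
  rcases cross_span_subset hh with hh | hh <;> rcases cross_span_subset hk with hk | hk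
  · exact hc.pairwise h hh k hk
  · exact Or.inr (Or.inr ((hU' hk).2 h (hU hh)).symm)
  · exact Or.inr (Or.inr ((hU' hh).2 k (hU hk)))
  · exact hc'.pairwise h hh k hk

/-- Every cube of a product is the product of its gate images in the two factors. -/
theorem eq_image_orthMap (hX : X.IsCAT0) (hS : X.IsConvexSet S) (ha : a ∈ S) (hd : d ∈ X.cubes)
    (hdP : d ⊆ X.copies S a) :
    d = X.orthMap S '' ((X.gate S '' d) ×ˢ (X.gate (X.orth S a) '' d)) := by
  rw [mem_cubes_iff hX] at hd
  ext z
  constructor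
  · intro hz
    exact ⟨_, ⟨⟨z, hz, rfl⟩, ⟨z, hz, rfl⟩⟩, orthMap_gates hX hS ha (hdP hz)⟩
  · rintro ⟨⟨_, _⟩, ⟨⟨u, hu, rfl⟩, ⟨v, hv, rfl⟩⟩, rfl⟩
    rw [hd.convex.eq_span hX hu]
    intro h hh hs
    rcases sep_mem_of_span (hdP hu) (orthMap_mem_copies hX ha (hS.gate_mem hX u)) hh hs with hk | hk
    · rw [orthMap_mem_iff_left hX hk, hS.gate_mem_iff hX hk] at hs
      exact absurd Iff.rfl hs
    · rw [orthMap_mem_iff_right hX (hS.gate_mem hX u) hk,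
        (orth_isConvexSet hX).gate_mem_iff hX (by rwa [cross_orth hX ha])] at hs
      exact mem_cross_of_sep hh hu hv hs

theorem isOrthCompl_full (hX : X.IsCAT0) (hA : A.IsConvex) (ha : a ∈ A.verts) :
    IsOrthCompl A a (X.full (X.orth A.verts a)) := by
  have hS := hA.isConvexSet ⟨a, ha⟩
  refine ⟨ha, by rw [verts_full]; exact self_mem_span, (orth_isConvexSet hX).isConvex_full,
    X.orthMap A.verts, fun x hx => orthMap_left hX ha hx, ?_, ?_, ?_⟩
  · rw [verts_full]
    exact fun y hy => orthMap_right hX ha hy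
  · rw [verts_full]
    exact fun x hx y hy x' hx' y' hy' => dist_orthMap hX ha hx hy hx' hy'
  · rw [parallelHull_eq_full hX hA ha]
    ext d
    constructor
    · rintro ⟨hd, hdP⟩
      refine ⟨_, hA.1 _ (gate_image_mem_cubes hX hS hd) ?_, _,
        ⟨gate_image_mem_cubes hX (orth_isConvexSet hX) hd, ?_⟩, eq_image_orthMap hX hS ha hd hdP⟩
      · rintro _ ⟨z, -, rfl⟩; exact hS.gate_mem hX z
      · rintro _ ⟨z, -, rfl⟩; exact (orth_isConvexSet hX).gate_mem hX z
    · rintro ⟨c, hc, c', hc', rfl⟩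
      refine ⟨image_orthMap_mem_cubes hX hS ha (A.subset hc) (A.subset_verts hc) hc'.1 hc'.2, ?_⟩
      rintro _ ⟨⟨x, y⟩, ⟨hx, -⟩, rfl⟩
      exact orthMap_mem_copies hX ha (A.subset_verts hc hx)

theorem IsHalf.mem_of_between (hX : X.IsCAT0) (hh : X.IsHalf h) (hx : x ∈ h) (hy : y ∈ h)
    (hz : X.graph.dist x y = X.graph.dist x z + X.graph.dist z y) : z ∈ h :=
  (hh.isConvexSet hX).mem x hx y hy z hz.symm

/-- A halfspace separating `a` from a vertex of an orthogonal complement at `a` is transverse to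
every halfspace crossed by `A`: both separate the corners of a metric rectangle, along
different sides. -/
theorem IsOrthCompl.verts_subset (hX : X.IsCAT0) (hO : IsOrthCompl A a O) :
    O.verts ⊆ X.orth A.verts a := by
  obtain ⟨ha, haO, -, φ, h₁, h₂, hd, -⟩ := hO
  intro y hy
  have key : ∀ h, X.IsHalf h → a ∈ h → y ∉ h → h ∈ X.perp (X.Cross A.verts) := by
    intro h hh hah hyh
    have hhc := hh.compl hX
    have hxh : ∀ x ∈ A.verts, x ∈ h ∧ φ (x, y) ∉ h := by
      intro x hx
      constructor
      · by_contra hxh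
        refine hhc.mem_of_between hX hxh hyh (z := a) ?_ hah
        have e := hd x hx a haO a ha y hy
        rwa [h₁ x hx, h₂ y hy] at e
      · intro hq
        refine hyh (hh.mem_of_between hX hah hq (z := y) ?_)
        have e₁ := hd a ha a haO x hx y hy
        have e₂ := hd a ha y hy x hx y hy
        rw [h₁ a ha] at e₁
        rw [h₂ y hy, SimpleGraph.dist_self] at e₂
        omega
    have hk : ∀ k, X.IsHalf k → ∀ x ∈ A.verts, ∀ x' ∈ A.verts, x ∈ k → x' ∉ k → φ (x, y) ∈ k := by
      intro k hk x hx x' hx' hxk hxk'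
      by_contra hq
      refine (hk.compl hX).mem_of_between hX hxk' hq (z := x) ?_ hxk
      have e₁ := hd x' hx' a haO x hx y hy
      have e₂ := hd x hx a haO x hx y hy
      rw [h₁ x' hx'] at e₁
      rw [h₁ x hx, SimpleGraph.dist_self] at e₂
      omega
    refine ⟨hh, ?_⟩
    rintro k ⟨hkh, ⟨x, hx, hxk⟩, x', hx', hxk'⟩
    exact ⟨⟨x, (hxh x hx).1, hxk⟩, ⟨x', (hxh x' hx').1, hxk'⟩,
      ⟨_, (hxh x hx).2, hk k hkh x hx x' hx' hxk hxk'⟩,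
      ⟨_, (hxh x' hx').2, hk kᶜ (hkh.compl hX) x' hx' x hx hxk' fun h => h hxk⟩⟩
  intro h hh hs
  by_cases hah : a ∈ h
  · exact key h hh hah fun h' => hs (iff_of_true hah h')
  · have := perp_compl hX (key hᶜ (hh.compl hX) hah fun h' => hs (iff_of_false hah h'))
    rwa [compl_compl] at this

/-- The orthogonal complement of a convex subcomplex exists and is unique. -/
theorem isOrthCompl_iff (hX : X.IsCAT0) (hA : A.IsConvex) (ha : a ∈ A.verts) :
    IsOrthCompl A a O ↔ O = X.full (X.orth A.verts a) := by
  refine ⟨fun hO => ?_, fun h => h ▸ isOrthCompl_full hX hA ha⟩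
  refine hO.2.2.1.ext (orth_isConvexSet hX).isConvex_full ?_
  rw [verts_full]
  refine (hO.verts_subset hX).antisymm fun y hy => ?_
  obtain ⟨-, haO, -, φ, h₁, h₂, hd, himg⟩ := hO
  rw [parallelHull_eq_full hX hA ha] at himg
  have hyP : {y} ∈ (X.full (X.copies A.verts a)).cubes :=
    ⟨X.singleton_mem y, Set.singleton_subset_iff.2 (span_mono Set.subset_union_right hy)⟩
  rw [himg] at hyP
  obtain ⟨c, hc, c', hc', he⟩ := hyP
  obtain ⟨⟨x, o⟩, ⟨hx, ho⟩, hxo⟩ := (he ▸ rfl : y ∈ φ '' (c ×ˢ c'))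
  replace hx : x ∈ A.verts := A.subset_verts hc hx
  replace ho : o ∈ O.verts := O.subset_verts hc' ho
  have hxa : x = a := by
    by_contra hne
    obtain ⟨h, hh, hxh, hah⟩ := exists_sep hX hne
    have hhA : h ∈ X.Cross A.verts := ⟨hh, ⟨x, hx, hxh⟩, a, ha, hah⟩
    have hyh : y ∉ h := fun hyh => disjoint_perp hhA (hy h hh fun e => hah (e.2 hyh))
    refine (hh.compl hX).mem_of_between hX hah hyh (z := x) ?_ hxh
    have e₁ := hd a ha a haO x hx o ho
    have e₂ := hd x hx a haO x hx o ho
    rw [h₁ a ha, hxo] at e₁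
    rw [h₁ x hx, hxo, SimpleGraph.dist_self] at e₂
    omega
  subst hxa
  rw [h₂ o ho] at hxo
  exact hxo ▸ ho

end Orthogonal

/-! ### The hyperclosure -/

section Hyperclosure

variable {F F' : X.Subcomplex} {U : Set (Set V)} {S : Set V} {a x y : V}

/-- The halfspaces crossed by `F` are those transverse to all members of some finite set of
halfspaces. -/
def IsFinitelyCut (F : X.Subcomplex) : Prop :=
  F.IsConvex ∧ F.verts.Nonempty ∧
    ∃ U : Set (Set V), U.Finite ∧ (∀ h ∈ U, X.IsHalf h) ∧ X.Cross F.verts = X.perp U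

theorem verts_whole : X.whole.verts = Set.univ := by
  ext v; exact ⟨fun _ => trivial, fun _ => X.singleton_mem v⟩

theorem isConvex_whole : X.whole.IsConvex :=
  ⟨fun _ hc _ => hc, fun _ _ _ _ z _ => X.singleton_mem z⟩

theorem cross_univ : X.Cross Set.univ = X.perp ∅ := by
  ext h
  constructor
  · exact fun hh => ⟨hh.1, fun k hk => hk.elim⟩
  · rintro ⟨hh, -⟩
    obtain ⟨a, b, hab, rfl⟩ := id hh
    exact ⟨hh, ⟨a, trivial, left_mem_side hab⟩, b, trivial, right_notMem_side⟩

theorem isHyperclosed_isFinitelyCut (hX : X.IsCAT0) :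
    X.IsHyperclosed {F | IsFinitelyCut F} where
  convex F hF := ⟨hF.1, hF.2.1⟩
  whole_mem := by
    refine ⟨isConvex_whole, ?_, ∅, Set.finite_empty, fun _ h => h.elim, ?_⟩
    · rw [verts_whole]; exact ⟨hX.1.1.nonempty.some, trivial⟩
    · rw [verts_whole, cross_univ]
  combHyperplane_mem K hK := by
    obtain ⟨h, hh, rfl⟩ := hK.exists_eq_frontier hX
    have hconv := frontier_isConvexSet hX hh
    refine ⟨hconv.isConvex_full, by rw [verts_full]; exact hconv.nonempty, {h},
      Set.finite_singleton h, ?_, ?_⟩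
    · rintro _ rfl; exact hh
    · rw [verts_full, cross_frontier hX hh]
  gate_mem := by
    rintro F ⟨hF, hne, U, hU, hUh, hFU⟩ F' ⟨hF', hne', U', hU', hUh', hFU'⟩
    have hS := hF.isConvexSet hne
    have hconv := (gate_image_isConvexSet hX hS (hF'.isConvexSet hne')).1
    change IsFinitelyCut _
    rw [gateImage_eq_full hX hS hF' hne']
    refine ⟨hconv.isConvex_full, by rw [verts_full]; exact hconv.nonempty, U ∪ U', hU.union hU',
      ?_, ?_⟩
    · rintro h (hh | hh)
      exacts [hUh h hh, hUh' h hh]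
    · rw [verts_full, cross_gate_image hX hS, hFU, hFU', perp_union]
  parallel_mem := by
    rintro F ⟨hF, hne, U, hU, hUh, hFU⟩ F' hF' hne' hp
    rw [parallel_iff hX hF' hne' hF hne] at hp
    exact ⟨hF', hne', U, hU, hUh, hp.trans hFU⟩

/-- For finite `U`, iterated gate images of combinatorial hyperplanes cross exactly `perp U`. -/
theorem IsHyperclosed.exists_cross_eq_perp (hX : X.IsCAT0) {𝓕 : Set X.Subcomplex}
    (h𝓕 : X.IsHyperclosed 𝓕) (hU : U.Finite) (hUh : ∀ h ∈ U, X.IsHalf h) :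
    ∃ F ∈ 𝓕, X.Cross F.verts = X.perp U := by
  induction U, hU using Set.Finite.induction_on with
  | empty => exact ⟨_, h𝓕.whole_mem, by rw [verts_whole, cross_univ]⟩
  | @insert h U _ _ ih =>
    obtain ⟨F, hF, hFU⟩ := ih fun k hk => hUh k (Set.mem_insert_of_mem _ hk)
    have hh := hUh h (Set.mem_insert h U)
    have hconv := frontier_isConvexSet hX hh
    have hmem := h𝓕.gate_mem _ (h𝓕.combHyperplane_mem _ (isCombHyperplane_frontier hX hh)) _ hF
    refine ⟨_, hmem, ?_⟩
    rw [gateImage_eq_full hX (by rwa [verts_full]) (h𝓕.convex F hF).1 (h𝓕.convex F hF).2,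
      verts_full, verts_full, cross_gate_image hX hconv, hFU, cross_frontier hX hh, ← perp_union,
      Set.singleton_union]

theorem mem_hyperclosure_iff (hX : X.IsCAT0) : F ∈ X.hyperclosure ↔ IsFinitelyCut F := by
  constructor
  · exact fun hF => hF _ (isHyperclosed_isFinitelyCut hX)
  · rintro ⟨hF, hne, U, hU, hUh, hFU⟩ 𝓕 h𝓕
    obtain ⟨F', hF', hFU'⟩ := IsHyperclosed.exists_cross_eq_perp hX h𝓕 hU hUh
    have := h𝓕.convex F' hF'
    exact h𝓕.parallel_mem F' hF' F hF hne
      ((parallel_iff hX hF hne this.1 this.2).2 (hFU.trans hFU'.symm))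

theorem finite_separators (hX : X.IsCAT0) (x y : V) :
    {h | X.IsHalf h ∧ ¬ (x ∈ h ↔ y ∈ h)}.Finite := by
  refine ((sep_finite hX x y).union (sep_finite hX y x)).subset ?_
  rintro h ⟨hh, hs⟩
  by_cases hx : x ∈ h
  · exact Or.inl ⟨hh, hx, fun hy => hs (iff_of_true hx hy)⟩
  · exact Or.inr ⟨hh, by by_contra hy; exact hs (iff_of_false hx hy), hx⟩

theorem finite_cross (hX : X.IsCAT0) (hS : S.Finite) : (X.Cross S).Finite := by
  refine (hS.biUnion fun x _ => hS.biUnion fun y _ => sep_finite hX x y).subset ?_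
  rintro h ⟨hh, ⟨x, hx, hxh⟩, y, hy, hyh⟩
  simp only [Set.mem_iUnion]
  exact ⟨x, hx, y, hy, hh, hxh, hyh⟩

theorem finite_span (hX : X.IsCAT0) (hU : U.Finite) : (X.span a U).Finite := by
  refine Set.Finite.of_finite_image (f := fun x => {h ∈ U | x ∈ h})
    (hU.finite_subsets.subset ?_) ?_
  · rintro _ ⟨x, -, rfl⟩
    exact Set.sep_subset _ _
  · intro x hx y hy he
    by_contra hne
    obtain ⟨h, hh, hxh, hyh⟩ := exists_sep hX hne
    have hhU := sep_mem_of_span hx hy hh fun e => hyh (e.1 hxh)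
    exact hyh ((Set.ext_iff.1 he h).1 ⟨hhU, hxh⟩).2

/-- A finite set of halfspaces cutting out the halfspaces crossed by `S` can be replaced by the
halfspaces crossed by a finite convex set containing a given vertex `a` of `S`: the one spanned by
the gates of `a` in the members of `U` and their complements. -/
theorem exists_finite_cross_perp_eq (hX : X.IsCAT0) (ha : a ∈ S) (hU : U.Finite)
    (hUh : ∀ h ∈ U, X.IsHalf h) (hS : X.Cross S = X.perp U) :
    ∃ C, X.IsConvexSet C ∧ C.Finite ∧ a ∈ C ∧ X.perp (X.Cross C) = X.Cross S := by
  let T : Set (Set V) := ⋃ h ∈ U, ({k | X.IsHalf k ∧ ¬ (a ∈ k ↔ X.gate h a ∈ k)} ∪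
    {k | X.IsHalf k ∧ ¬ (a ∈ k ↔ X.gate hᶜ a ∈ k)})
  have hT : T.Finite := hU.biUnion fun h _ =>
    (finite_separators hX _ _).union (finite_separators hX _ _)
  have hperp : ∀ h ∈ U, h ∈ X.perp (X.Cross S) := fun h hh => hS ▸ subset_perp_perp hUh hh
  have hTS : T ⊆ X.perp (X.Cross S) := by
    intro k hk
    simp only [T, Set.mem_iUnion] at hk
    obtain ⟨h, hh, hk | hk⟩ := hk
    · exact gate_mem_span_perp hX ha (hperp h hh) k hk.1 hk.2
    · exact gate_mem_span_perp hX ha (perp_compl hX (hperp h hh)) k hk.1 hk.2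
  have hUT : U ⊆ X.Cross (X.span a T) := by
    intro h hh
    refine ⟨hUh h hh, ⟨X.gate h a, fun k hk hs => ?_, ((hUh h hh).isConvexSet hX).gate_mem hX a⟩,
      X.gate hᶜ a, fun k hk hs => ?_, (((hUh h hh).compl hX).isConvexSet hX).gate_mem hX a⟩
    · exact Set.mem_biUnion hh (Or.inl ⟨hk, hs⟩)
    · exact Set.mem_biUnion hh (Or.inr ⟨hk, hs⟩)
  refine ⟨X.span a T, span_isConvexSet hX, finite_span hX hT, self_mem_span,
    (perp_anti hUT).trans_eq hS.symm |>.antisymm ?_⟩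
  exact (subset_perp_perp fun h hh => hh.1).trans (perp_anti (cross_span_subset.trans hTS))

end Hyperclosure

end CubeComplex

theorem mainTheorem3 {V : Type*} (X : CubeComplex V) (hX : X.IsCAT0) (hlf : X.IsLocallyFinite) :
    -- the orthogonal complement of a convex subcomplex at a vertex exists and is unique
    (∀ A : X.Subcomplex, A.IsConvex → ∀ a ∈ A.verts,
      ∃! O : X.Subcomplex, CubeComplex.IsOrthCompl A a O) ∧
    -- the characterisation of the hyperclosure
    (∀ F : X.Subcomplex, F.IsConvex → F.verts.Nonempty →
      (F ∈ X.hyperclosure ↔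
        ∃ C : X.Subcomplex, C.IsConvex ∧ C.IsCompact ∧
          ∃ a ∈ C.verts, CubeComplex.IsOrthCompl C a F)) ∧
    -- the double orthogonal complement
    (∀ F ∈ X.hyperclosure, ∀ f ∈ F.verts, ∀ O : X.Subcomplex,
      CubeComplex.IsOrthCompl F f O → CubeComplex.IsOrthCompl O f F) := by
  open CubeComplex in
  refine ⟨fun A hA a ha => ?_, fun F hF hne => ?_, fun F hF f hf O hO => ?_⟩
  · exact ⟨_, isOrthCompl_full hX hA ha, fun O hO => (isOrthCompl_iff hX hA ha).1 hO⟩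
  · rw [mem_hyperclosure_iff hX]
    constructor
    · rintro ⟨-, ⟨a, ha⟩, U, hU, hUh, hFU⟩
      obtain ⟨C, hC, hfin, haC, hCF⟩ := exists_finite_cross_perp_eq hX ha hU hUh hFU
      have haC' : a ∈ (X.full C).verts := by rwa [verts_full]
      refine ⟨X.full C, hC.isConvex_full, Subcomplex.isCompact_iff.2 (by rwa [verts_full]), a,
        haC', (isOrthCompl_iff hX hC.isConvex_full haC').2 ?_⟩
      rw [verts_full, orth, hCF, ← (hF.isConvexSet hne).eq_span hX ha]
      exact hF.eq_full
    · rintro ⟨C, hC, hcpt, a, ha, hO⟩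
      refine ⟨hF, hne, X.Cross C.verts, finite_cross hX (Subcomplex.isCompact_iff.1 hcpt),
        fun h hh => hh.1, ?_⟩
      rw [(isOrthCompl_iff hX hC ha).1 hO, verts_full, cross_orth hX ha]
  · obtain ⟨hFc, hne, U, -, hUh, hFU⟩ := (mem_hyperclosure_iff hX).1 hF
    obtain rfl := (isOrthCompl_iff hX hFc hf).1 hO
    have hconv : X.IsConvexSet (X.orth F.verts f) := orth_isConvexSet hX
    refine (isOrthCompl_iff hX hconv.isConvex_full (by rw [verts_full]; exact self_mem_span)).2 ?_
    rw [verts_full, orth, cross_orth hX hf, hFU, perp_perp_perp hUh, ← hFU,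
      ← (hFc.isConvexSet hne).eq_span hX hf]
    exact hFc.eq_full
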